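/- **Setting.** Let $\mathbb O$ be the octonions with standard basis $e_0=1,e_1,\dots,e_7$. A (unital) $\mathbb O$-bimodule is a real vector space with real-bilinear left and right multiplications by octonions such that $[p,q,x]=[q,x,p]=[x,p,q]=-[q,p,x]$ and $[x,p,q]=-[x,q,p]$, where $[a,b,c]=(ab)c-a(bc)$. Its real part is $\operatorname{Re}M=\{m:[p,q,m]=0\ \forall p,q\in\mathbb O\}$, and the real part operator is $\operatorname{Re}m=\frac5{12}m-\frac1{12}\sum_{i=1}^7e_ime_i$. A Hilbert $\mathbb O$-bimodule $H$ is an $\mathbb O$-bimodule with an $\mathbb R$-bilinear map $\langle\cdot,\cdot\rangle:H\times H\to\mathbb O$ such that $\operatorname{Re}(\langle u,v\rangle p-\langle u,vp\rangle)=0$, $\langle u,v\rangle=\overline{\langle v,u\rangle}$, and $\langle u,u\rangle=\|u\|^2$ for a complete norm. A real-linear map $f:H\to H$ is (right) para-linear if $\operatorname{Re}B_p(f,x)=0$ for all $p,x$, where $B_p(f,x)=f(x)p-f(xp)$. On the space $\mathscr B_{\mathcal{RO}}(H)$ of bounded para-linear operators put $$(p\odot f)(x)=p f(x)+B_p(f,x),\qquad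 (f\odot p)(x)=f(px)-B_p(f,x),$$ $$(f\circledcirc g)(x)=\sum_{i=0}^7e_i\operatorname{Re}\big(f(g(x\overline{e_i}))\big),\qquad \operatorname{Re}f=\tfrac5{12}f-\tfrac1{12}\sum_{i=1}^7e_i\odot f\odot e_i .$$ An operator $S$ is the adjoint $T^*$ of $T$ if $\langle Sy,x\rangle=\sum_{i=0}^7e_i\operatorname{Re}\langle y,T(x\overline{e_i})\rangle$ for all $x,y$ (that is, $S y$ represents $\langle y,\cdot\rangle\circledcirc T$; equivalently, $S$ is the adjoint of $T$ for the real inner product $\operatorname{Re}\langle\cdot,\cdot\rangle$). The slice cone is $\mathbb C(H)=\bigcup_J(\operatorname{Re}H+J\operatorname{Re}H)$, where $J$ runs over the imaginary octonions with $|J|=1$. A weak associative orthonormal basis is a maximal set $B\subset H$ such that $\langle z,w\rangle=\delta_{zw}$ and $\langle z,w\rangle p=\langle z,wp\rangle$ for all $z,w\in B$, $p\in\mathbb O$. An eigenvalue $\mu$ of $T$ is standard strong if there is an orthonormal system $S\subset\mathbb C(H)$ with $Tz=z\mu$ for $z\in S$ such that $\{x:Tx=x\mu\}$ is contained in the closed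 $\mathbb O$-linear span of $S$. **Theorem.** Let $H$ be a Hilbert $\mathbb O$-bimodule and let $T\in\mathscr B_{\mathcal{RO}}(H)$ be compact and self-adjoint ($T=T^*$), and suppose that all its real eigenvalues are standard strong (in particular, this holds if all its eigenvalues are). Then there is a weak associative orthonormal basis $(z_i)_{i\in I}$ of $H$ with $z_i\in\mathbb C(H)$ and $Tz_i=\lambda_iz_i$, $\lambda_i\in\mathbb R$. Fix any such basis, put $P_{z}(x)=z\langle z,x\rangle$, $\sigma(T)=\{\lambda_i\}\cup\{0\}$, and let $\mathcal R$ be the set of bounded functions $f:\sigma(T)\to\mathbb O$ with the pointwise operations, $f^*(q)=\overline{f(q)}$ and $\|f\|=\sup_{\sigma(T)}|f|$; let $\operatorname{Re}\mathcal R$ be the set of real-valued $f\in\mathcal R$. Then for every $f\in\mathcal R$ the series $$\Phi(f)x=\sum_{i\in I}(P_{z_i}\odot f(\lambda_i))(x),\qquad \Psi(f)x=\sum_{i\in I}(f(\lambda_i)\odot P_{z_i})(x)$$ converge unconditionally for every $x\in H$ and define operators $\Phi(f),\Psi(f)\in\mathscr B_{\mathcal{RO}}(H)$, such that: 1. (Powers)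 For all $k\in\mathbb N$ (including $k=0$), $\Phi(q^k)=\Psi(q^k)=T^{\circledcirc k}$, where $T^{\circledcirc k}$ is the unique operator in $\mathscr B_{\mathcal{RO}}(H)$ with $T^{\circledcirc k}(x)=T^k(x)$ for all $x\in\operatorname{Re}H$. 2. (Para-linearity) $\Phi$ and $\Psi$ are real-linear, and for $f\in\mathcal R$, $p\in\mathbb O$: $\operatorname{Re}(\Phi(f)\odot p-\Phi(fp))=0$ and $\operatorname{Re}(p\odot\Psi(f)-\Psi(pf))=0$. 3. (Multiplicativity of the real part) $\operatorname{Re}\Phi(fg)=\operatorname{Re}(\Phi(f)\circledcirc\Phi(g))$ for $f\in\operatorname{Re}\mathcal R$, $g\in\mathcal R$; and $\operatorname{Re}\Psi(fg)=\operatorname{Re}(\Psi(f)\circledcirc\Psi(g))$ for $f,g\in\mathcal R$ at least one of which is in $\operatorname{Re}\mathcal R$. 4. (Involution) $\Phi(f^*)=\Psi(f)^*$ and $\Psi(f^*)=\Phi(f)^*$ for $f\in\mathcal R$. 5. (Norm bounds) $\|\Phi(f)\|\le\|f\|$ and $\|\Psi(f)\|\le\|f\|$ for $f\in\operatorname{Re}\mathcal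 R$; $\|\Phi(f)\|\le8\|f\|$ and $\|\Psi(f)\|\le8\|f\|$ for $f\in\mathcal R$. -/

import Mathlib

noncomputable section

/-- The octonions `x = c0 + c1 e₁ + ⋯ + c7 e₇`, by their real coordinates. -/
@[ext]
structure Octonion where
  c0 : ℝ
  c1 : ℝ
  c2 : ℝ
  c3 : ℝ
  c4 : ℝ
  c5 : ℝ
  c6 : ℝ
  c7 : ℝ

namespace Octonion

instance : Zero Octonion := ⟨⟨0, 0, 0, 0, 0, 0, 0, 0⟩⟩

instance : One Octonion := ⟨⟨1, 0, 0, 0, 0, 0, 0, 0⟩⟩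

instance : Add Octonion := ⟨fun x y =>
  ⟨x.c0 + y.c0, x.c1 + y.c1, x.c2 + y.c2, x.c3 + y.c3, x.c4 + y.c4, x.c5 + y.c5, x.c6 + y.c6, x.c7 + y.c7⟩⟩

instance : Neg Octonion := ⟨fun x => ⟨-x.c0, -x.c1, -x.c2, -x.c3, -x.c4, -x.c5, -x.c6, -x.c7⟩⟩

instance : Sub Octonion := ⟨fun x y =>
  ⟨x.c0 - y.c0, x.c1 - y.c1, x.c2 - y.c2, x.c3 - y.c3, x.c4 - y.c4, x.c5 - y.c5, x.c6 - y.c6, x.c7 - y.c7⟩⟩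

instance : SMul ℝ Octonion := ⟨fun r x =>
  ⟨r * x.c0, r * x.c1, r * x.c2, r * x.c3, r * x.c4, r * x.c5, r * x.c6, r * x.c7⟩⟩

instance : AddCommGroup Octonion where
  add_assoc _ _ _ := Octonion.ext (add_assoc _ _ _) (add_assoc _ _ _) (add_assoc _ _ _)
    (add_assoc _ _ _) (add_assoc _ _ _) (add_assoc _ _ _) (add_assoc _ _ _) (add_assoc _ _ _)
  zero_add _ := Octonion.ext (zero_add _) (zero_add _) (zero_add _) (zero_add _)
    (zero_add _) (zero_add _) (zero_add _) (zero_add _)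
  add_zero _ := Octonion.ext (add_zero _) (add_zero _) (add_zero _) (add_zero _)
    (add_zero _) (add_zero _) (add_zero _) (add_zero _)
  add_comm _ _ := Octonion.ext (add_comm _ _) (add_comm _ _) (add_comm _ _) (add_comm _ _)
    (add_comm _ _) (add_comm _ _) (add_comm _ _) (add_comm _ _)
  neg_add_cancel _ := Octonion.ext (neg_add_cancel _) (neg_add_cancel _) (neg_add_cancel _)
    (neg_add_cancel _) (neg_add_cancel _) (neg_add_cancel _) (neg_add_cancel _) (neg_add_cancel _)
  sub_eq_add_neg _ _ := Octonion.ext (sub_eq_add_neg _ _) (sub_eq_add_neg _ _)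
    (sub_eq_add_neg _ _) (sub_eq_add_neg _ _) (sub_eq_add_neg _ _) (sub_eq_add_neg _ _)
    (sub_eq_add_neg _ _) (sub_eq_add_neg _ _)
  nsmul := nsmulRec
  zsmul := zsmulRec

instance : Module ℝ Octonion where
  one_smul _ := Octonion.ext (one_mul _) (one_mul _) (one_mul _) (one_mul _)
    (one_mul _) (one_mul _) (one_mul _) (one_mul _)
  mul_smul _ _ _ := Octonion.ext (mul_assoc _ _ _) (mul_assoc _ _ _) (mul_assoc _ _ _)
    (mul_assoc _ _ _) (mul_assoc _ _ _) (mul_assoc _ _ _) (mul_assoc _ _ _) (mul_assoc _ _ _)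
  smul_zero _ := Octonion.ext (mul_zero _) (mul_zero _) (mul_zero _) (mul_zero _)
    (mul_zero _) (mul_zero _) (mul_zero _) (mul_zero _)
  smul_add _ _ _ := Octonion.ext (mul_add _ _ _) (mul_add _ _ _) (mul_add _ _ _)
    (mul_add _ _ _) (mul_add _ _ _) (mul_add _ _ _) (mul_add _ _ _) (mul_add _ _ _)
  add_smul _ _ _ := Octonion.ext (add_mul _ _ _) (add_mul _ _ _) (add_mul _ _ _)
    (add_mul _ _ _) (add_mul _ _ _) (add_mul _ _ _) (add_mul _ _ _) (add_mul _ _ _)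
  zero_smul _ := Octonion.ext (zero_mul _) (zero_mul _) (zero_mul _) (zero_mul _)
    (zero_mul _) (zero_mul _) (zero_mul _) (zero_mul _)

/-- The bilinear product with unit `1 = e₀` and `eᵢ eⱼ = ε_{ijk} e_k - δ_{ij}` for `i, j ≥ 1`,
where `ε_{ijk} = 1` for the oriented triples `(123), (145), (176), (246), (257), (347), (365)`. -/
instance : Mul Octonion := ⟨fun x y =>
    ⟨x.c0 * y.c0 - x.c1 * y.c1 - x.c2 * y.c2 - x.c3 * y.c3 - x.c4 * y.c4 - x.c5 * y.c5 - x.c6 * y.c6 - x.c7 * y.c7,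
     x.c0 * y.c1 + x.c1 * y.c0 + x.c2 * y.c3 - x.c3 * y.c2 + x.c4 * y.c5 - x.c5 * y.c4 - x.c6 * y.c7 + x.c7 * y.c6,
     x.c0 * y.c2 - x.c1 * y.c3 + x.c2 * y.c0 + x.c3 * y.c1 + x.c4 * y.c6 + x.c5 * y.c7 - x.c6 * y.c4 - x.c7 * y.c5,
     x.c0 * y.c3 + x.c1 * y.c2 - x.c2 * y.c1 + x.c3 * y.c0 + x.c4 * y.c7 - x.c5 * y.c6 + x.c6 * y.c5 - x.c7 * y.c4,
     x.c0 * y.c4 - x.c1 * y.c5 - x.c2 * y.c6 - x.c3 * y.c7 + x.c4 * y.c0 + x.c5 * y.c1 + x.c6 * y.c2 + x.c7 * y.c3,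
     x.c0 * y.c5 + x.c1 * y.c4 - x.c2 * y.c7 + x.c3 * y.c6 - x.c4 * y.c1 + x.c5 * y.c0 - x.c6 * y.c3 + x.c7 * y.c2,
     x.c0 * y.c6 + x.c1 * y.c7 + x.c2 * y.c4 - x.c3 * y.c5 - x.c4 * y.c2 + x.c5 * y.c3 + x.c6 * y.c0 - x.c7 * y.c1,
     x.c0 * y.c7 - x.c1 * y.c6 + x.c2 * y.c5 + x.c3 * y.c4 - x.c4 * y.c3 - x.c5 * y.c2 + x.c6 * y.c1 + x.c7 * y.c0⟩⟩

/-- Octonionic conjugation. -/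
def conj (x : Octonion) : Octonion := ⟨x.c0, -x.c1, -x.c2, -x.c3, -x.c4, -x.c5, -x.c6, -x.c7⟩

/-- The real part of an octonion, as a real number. -/
def re (x : Octonion) : ℝ := x.c0

/-- The modulus `|x| = √(x x̄)`. -/
def abs (x : Octonion) : ℝ := Real.sqrt (x * conj x).re

/-- The standard basis `e₀ = 1, e₁, …, e₇`. -/
def e : Fin 8 → Octonion :=
  ![⟨1, 0, 0, 0, 0, 0, 0, 0⟩, ⟨0, 1, 0, 0, 0, 0, 0, 0⟩,
    ⟨0, 0, 1, 0, 0, 0, 0, 0⟩, ⟨0, 0, 0, 1, 0, 0, 0, 0⟩,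
    ⟨0, 0, 0, 0, 1, 0, 0, 0⟩, ⟨0, 0, 0, 0, 0, 1, 0, 0⟩,
    ⟨0, 0, 0, 0, 0, 0, 1, 0⟩, ⟨0, 0, 0, 0, 0, 0, 0, 1⟩]

/-- The octonion `x` is a real number. -/
def IsReal (x : Octonion) : Prop := ∃ r : ℝ, x = r • (1 : Octonion)

end Octonion

/-- A (unital) `𝕆`-bimodule: a real vector space with real-bilinear left and right multiplications
`lmul p x = p x` and `rmul x p = x p` by octonions, such that
`[p, q, x] = [q, x, p] = [x, p, q] = -[q, p, x]` and `[x, p, q] = -[x, q, p]`. -/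
class OctBimodule (M : Type*) [AddCommGroup M] [Module ℝ M] where
  lmul : Octonion →ₗ[ℝ] M →ₗ[ℝ] M
  rmul : M →ₗ[ℝ] Octonion →ₗ[ℝ] M
  one_lmul : ∀ x : M, lmul 1 x = x
  rmul_one : ∀ x : M, rmul x 1 = x
  assoc_right_alt : ∀ (x : M) (p q : Octonion),
    rmul (rmul x p) q - rmul x (p * q) = -(rmul (rmul x q) p - rmul x (q * p))
  assoc_left_eq_middle : ∀ (x : M) (p q : Octonion),
    lmul (p * q) x - lmul p (lmul q x) = rmul (lmul q x) p - lmul q (rmul x p)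
  assoc_middle_eq_right : ∀ (x : M) (p q : Octonion),
    rmul (lmul q x) p - lmul q (rmul x p) = rmul (rmul x p) q - rmul x (p * q)
  assoc_left_alt : ∀ (x : M) (p q : Octonion),
    lmul (p * q) x - lmul p (lmul q x) = -(lmul (q * p) x - lmul q (lmul p x))

section Bimodule

open OctBimodule

variable {M : Type*} [AddCommGroup M] [Module ℝ M] [OctBimodule M]

/-- `Re M = {m | [p, q, m] = 0 for all p, q}`. -/
def octRe (M : Type*) [AddCommGroup M] [Module ℝ M] [OctBimodule M] : Set M :=
  {m | ∀ p q : Octonion, lmul (p * q) m - lmul p (lmul q m) = 0}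

/-- The real part operator `Re x = (5/12) x - (1/12) ∑_{i=1}^7 eᵢ x eᵢ` of a bimodule. -/
def octRePart : M →ₗ[ℝ] M :=
  (5 / 12 : ℝ) • LinearMap.id - (1 / 12 : ℝ) • ∑ i : Fin 7,
    rmul.flip (Octonion.e i.succ) ∘ₗ lmul (Octonion.e i.succ)

/-- The second right associator `B_p(f, x) = f(x) p - f(x p)`, as a linear map in `x`. -/
def octB (p : Octonion) (f : M →ₗ[ℝ] M) : M →ₗ[ℝ] M :=
  rmul.flip p ∘ₗ f - f ∘ₗ rmul.flip p

/-- Right para-linear maps: `Re B_p(f, x) = 0` for all `p` and `x`. -/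
def IsParaLinear (f : M →ₗ[ℝ] M) : Prop :=
  ∀ (p : Octonion) (x : M), octRePart (octB p f x) = 0

/-- `(p ⊙ f)(x) = p f(x) + B_p(f, x)`. -/
def octLSmul (p : Octonion) (f : M →ₗ[ℝ] M) : M →ₗ[ℝ] M := lmul p ∘ₗ f + octB p f

/-- `(f ⊙ p)(x) = f(p x) - B_p(f, x)`. -/
def octRSmul (f : M →ₗ[ℝ] M) (p : Octonion) : M →ₗ[ℝ] M := f ∘ₗ lmul p - octB p f

/-- The real part operator of the bimodule of para-linear maps:
`Re f = (5/12) f - (1/12) ∑_{i=1}^7 eᵢ ⊙ f ⊙ eᵢ`. -/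
def octOpRe (f : M →ₗ[ℝ] M) : M →ₗ[ℝ] M :=
  (5 / 12 : ℝ) • f - (1 / 12 : ℝ) • ∑ i : Fin 7,
    octRSmul (octLSmul (Octonion.e i.succ) f) (Octonion.e i.succ)

/-- The regular composition `(f ⊚ g)(x) = ∑_{i=0}^7 eᵢ Re (f (g (x ēᵢ)))`, the para-linear map
whose real part is that of `f (g x)`. -/
def octComp (f g : M →ₗ[ℝ] M) : M →ₗ[ℝ] M :=
  ∑ i : Fin 8, lmul (Octonion.e i) ∘ₗ octRePart ∘ₗ f ∘ₗ g ∘ₗ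
    rmul.flip (Octonion.conj (Octonion.e i))

/-- The slice cone `ℂ(M) = ⋃_J (Re M + J Re M)`, `J` running over the unit imaginary octonions. -/
def sliceCone (M : Type*) [AddCommGroup M] [Module ℝ M] [OctBimodule M] : Set M :=
  {z | ∃ J : Octonion, J.re = 0 ∧ J.abs = 1 ∧
    ∃ u ∈ octRe M, ∃ v ∈ octRe M, z = u + lmul J v}

end Bimodule

/-- The structure of a Hilbert `𝕆`-bimodule on a real Hilbert space `H` (completeness is asked for
separately): an `𝕆`-bimodule with a right `𝕆`-inner product that induces the norm of `H`. -/
class HilbertOctBimodule (H : Type*) [NormedAddCommGroup H] [InnerProductSpace ℝ H]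
    extends OctBimodule H where
  oinner : H →ₗ[ℝ] H →ₗ[ℝ] Octonion
  oinner_paraLinear : ∀ (u v : H) (p : Octonion), (oinner u v * p - oinner u (rmul v p)).re = 0
  oinner_hermitian : ∀ u v : H, oinner u v = (oinner v u).conj
  oinner_self : ∀ u : H, oinner u u = (‖u‖ ^ 2) • (1 : Octonion)

section Hilbert

open OctBimodule HilbertOctBimodule

variable {H : Type*} [NormedAddCommGroup H] [InnerProductSpace ℝ H] [HilbertOctBimodule H]

/-- `S` is the adjoint of `T`: for every `y`, the vector `S y` represents the para-linear functional
`⟨y, ·⟩ ⊚ T`, that is, `⟨S y, x⟩ = ∑_{i=0}^7 eᵢ Re ⟨y, T (x ēᵢ)⟩`. -/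
def IsOctAdjoint (T S : H →L[ℝ] H) : Prop :=
  ∀ x y : H, oinner (S y) x =
    ∑ i : Fin 8, (oinner y (T (rmul x (Octonion.e i).conj))).re • Octonion.e i

/-- The slice projection `P_z x = z ⟨z, x⟩`. -/
def sliceProj (z : H) : H →ₗ[ℝ] H := rmul z ∘ₗ oinner z

/-- Orthonormal systems for the `𝕆`-valued inner product. -/
def IsOctOrthonormal (S : Set H) : Prop :=
  (∀ x ∈ S, oinner x x = 1) ∧ ∀ x ∈ S, ∀ y ∈ S, x ≠ y → oinner x y = 0

/-- Weak associative orthonormal systems: orthonormal, and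
`B_p(x, y) = ⟨x, y⟩ p - ⟨x, y p⟩ = 0` for all members `x`, `y` and all `p`. -/
def IsWeakAssocOrthonormal (S : Set H) : Prop :=
  IsOctOrthonormal S ∧
    ∀ x ∈ S, ∀ y ∈ S, ∀ p : Octonion, oinner x y * p - oinner x (rmul y p) = 0

/-- `μ` is a standard strong eigenvalue of `T`: there is an orthonormal system of strong
eigenvectors for `μ` in the slice cone whose closed `𝕆`-linear span contains the eigenspace
`{x | T x = x μ}` (so it suffices that the eigenspace lies in the `𝕆`-linear span itself). -/
def IsStandardStrongEigenvalue (T : H →L[ℝ] H) (μ : Octonion) : Prop :=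
  ∃ S : Set H, S ⊆ sliceCone H ∧ IsOctOrthonormal S ∧ (∀ z ∈ S, T z = rmul z μ) ∧
    ∀ x : H, T x = rmul x μ →
      x ∈ closure (Submodule.span ℝ {y : H | ∃ z ∈ S, ∃ p : Octonion, y = rmul z p} : Set H)

/-- `B` is a weak associative orthonormal basis (a maximal weak associative orthonormal system) of
strong eigenvectors of `T` in the slice cone, and `T z = lam z • z` with `lam z` real for `z ∈ B`. -/
def IsEigenbasis (T : H →L[ℝ] H) (B : Set H) (lam : B → ℝ) : Prop :=
  Maximal IsWeakAssocOrthonormal B ∧ B ⊆ sliceCone H ∧ ∀ z : B, T z = lam z • (z : H)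

end Hilbert

/-- The spectrum `{λᵢ} ∪ {0}`. -/
def spectralSet {ι : Type*} (lam : ι → ℝ) : Set ℝ := Set.range lam ∪ {0}

/-- The point `λᵢ` of the spectrum. -/
def spectralPt {ι : Type*} (lam : ι → ℝ) (i : ι) : spectralSet lam :=
  ⟨lam i, Or.inl ⟨i, rfl⟩⟩

/-- Bounded octonion-valued functions. -/
def IsBddOct {X : Type*} (f : X → Octonion) : Prop :=
  BddAbove (Set.range fun q => (f q).abs)

/-- The supremum norm of an octonion-valued function. -/
def octSupNorm {X : Type*} (f : X → Octonion) : ℝ := ⨆ q, (f q).abs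

end

/-! The bimodule axioms force `H` to be `Re H ⊗ 𝕆`. Right multiplications by `e₁, …, e₇` satisfy the
Clifford relations, and left multiplication by `e₁` turns out to be a polynomial in them
(`leftDefect_eq_zero`). Its square being `-1` then fixes the action of the Clifford volume element
(`rmul_volume`), so a signed average over the lines of the Fano plane projects onto the nucleus.
Hence every vector is a sum of octonion multiples of real vectors (`octRe_induction`), para-linear
maps are the maps that are right linear on `Re H` (`isParaLinear_iff`), and the octonionic inner
product is the tensor product of the real one on `Re H` with that of `𝕆`
(`oinner_rmul_rmul_of_mem`).

Nonassociativity is controlled by slices: `Re H + J Re H` is a complex Hilbert space with imaginary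
unit `J`. Vectors of two slices `J`, `K` that are orthogonal over both complex units lie in one
slice or have mutually orthogonal real components, because the linear systems for these components
have determinant `1 - ⟨J, K⟩²` (`mem_slice_or_inner_eq_zero`). Consequently orthonormal systems in
the slice cone are weak associative, maximal ones among them are complete
(`octSpan_eq_top_of_maximal`), and eigenvectors in the cone for distinct real eigenvalues are
octonionically orthogonal. The real spectral theorem then makes the union of the given systems of
eigenvectors a basis (`exists_isEigenbasis`).

For a fixed basis the vectors `z eᵢ` form a real Hilbert basis, in which `∑ r_z P_z` is diagonal. By
the Moufang identities `P_z ⊙ eᵢ` and `eᵢ ⊙ P_z` are `P_z` placed between isometries, so expanding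
coefficients in coordinates writes `Φ f` and `Ψ f` as sums of eight operators of norm at most `‖f‖`.
The algebraic claims compare para-linear operators or their real parts and are therefore tested on
`Re H`. The delicate one is multiplicativity of `Ψ` with a real left factor
(`HasRightSum.octRePart_apply_lmul`). -/

namespace Octonion

/-! ### Octonion arithmetic in coordinates. -/

@[simp] lemma zero_c0 : (0 : Octonion).c0 = 0 := rfl
@[simp] lemma zero_c1 : (0 : Octonion).c1 = 0 := rfl
@[simp] lemma zero_c2 : (0 : Octonion).c2 = 0 := rfl
@[simp] lemma zero_c3 : (0 : Octonion).c3 = 0 := rfl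
@[simp] lemma zero_c4 : (0 : Octonion).c4 = 0 := rfl
@[simp] lemma zero_c5 : (0 : Octonion).c5 = 0 := rfl
@[simp] lemma zero_c6 : (0 : Octonion).c6 = 0 := rfl
@[simp] lemma zero_c7 : (0 : Octonion).c7 = 0 := rfl

lemma one_def : (1 : Octonion) = ⟨1, 0, 0, 0, 0, 0, 0, 0⟩ := rfl

lemma add_def (x y : Octonion) : x + y = ⟨x.c0 + y.c0, x.c1 + y.c1, x.c2 + y.c2, x.c3 + y.c3,
    x.c4 + y.c4, x.c5 + y.c5, x.c6 + y.c6, x.c7 + y.c7⟩ := rfl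

lemma neg_def (x : Octonion) :
    -x = ⟨-x.c0, -x.c1, -x.c2, -x.c3, -x.c4, -x.c5, -x.c6, -x.c7⟩ := rfl

lemma sub_def (x y : Octonion) : x - y = ⟨x.c0 - y.c0, x.c1 - y.c1, x.c2 - y.c2, x.c3 - y.c3,
    x.c4 - y.c4, x.c5 - y.c5, x.c6 - y.c6, x.c7 - y.c7⟩ := rfl

lemma smul_def (r : ℝ) (x : Octonion) : r • x = ⟨r * x.c0, r * x.c1, r * x.c2, r * x.c3,
    r * x.c4, r * x.c5, r * x.c6, r * x.c7⟩ := rfl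

lemma mul_def (x y : Octonion) : x * y =
    ⟨x.c0 * y.c0 - x.c1 * y.c1 - x.c2 * y.c2 - x.c3 * y.c3 - x.c4 * y.c4 - x.c5 * y.c5 - x.c6 * y.c6 - x.c7 * y.c7,
     x.c0 * y.c1 + x.c1 * y.c0 + x.c2 * y.c3 - x.c3 * y.c2 + x.c4 * y.c5 - x.c5 * y.c4 - x.c6 * y.c7 + x.c7 * y.c6,
     x.c0 * y.c2 - x.c1 * y.c3 + x.c2 * y.c0 + x.c3 * y.c1 + x.c4 * y.c6 + x.c5 * y.c7 - x.c6 * y.c4 - x.c7 * y.c5,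
     x.c0 * y.c3 + x.c1 * y.c2 - x.c2 * y.c1 + x.c3 * y.c0 + x.c4 * y.c7 - x.c5 * y.c6 + x.c6 * y.c5 - x.c7 * y.c4,
     x.c0 * y.c4 - x.c1 * y.c5 - x.c2 * y.c6 - x.c3 * y.c7 + x.c4 * y.c0 + x.c5 * y.c1 + x.c6 * y.c2 + x.c7 * y.c3,
     x.c0 * y.c5 + x.c1 * y.c4 - x.c2 * y.c7 + x.c3 * y.c6 - x.c4 * y.c1 + x.c5 * y.c0 - x.c6 * y.c3 + x.c7 * y.c2,
     x.c0 * y.c6 + x.c1 * y.c7 + x.c2 * y.c4 - x.c3 * y.c5 - x.c4 * y.c2 + x.c5 * y.c3 + x.c6 * y.c0 - x.c7 * y.c1,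
     x.c0 * y.c7 - x.c1 * y.c6 + x.c2 * y.c5 + x.c3 * y.c4 - x.c4 * y.c3 - x.c5 * y.c2 + x.c6 * y.c1 + x.c7 * y.c0⟩ :=
  rfl

lemma e_zero : e 0 = 1 := rfl
lemma e_one_def : e 1 = ⟨0, 1, 0, 0, 0, 0, 0, 0⟩ := rfl
lemma e_two_def : e 2 = ⟨0, 0, 1, 0, 0, 0, 0, 0⟩ := rfl
lemma e_three_def : e 3 = ⟨0, 0, 0, 1, 0, 0, 0, 0⟩ := rfl
lemma e_four_def : e 4 = ⟨0, 0, 0, 0, 1, 0, 0, 0⟩ := rfl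
lemma e_five_def : e 5 = ⟨0, 0, 0, 0, 0, 1, 0, 0⟩ := rfl
lemma e_six_def : e 6 = ⟨0, 0, 0, 0, 0, 0, 1, 0⟩ := rfl
lemma e_seven_def : e 7 = ⟨0, 0, 0, 0, 0, 0, 0, 1⟩ := rfl

instance : NonAssocRing Octonion where
  left_distrib a b c := by
    ext <;> simp only [mul_def, add_def] <;> ring
  right_distrib a b c := by
    ext <;> simp only [mul_def, add_def] <;> ring
  zero_mul a := by ext <;> simp [mul_def]
  mul_zero a := by ext <;> simp [mul_def]
  one_mul a := by ext <;> simp [mul_def, one_def]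
  mul_one a := by ext <;> simp [mul_def, one_def]

instance : IsScalarTower ℝ Octonion Octonion where
  smul_assoc r a b := by
    ext <;> simp only [mul_def, smul_def, smul_eq_mul] <;> ring

instance : SMulCommClass ℝ Octonion Octonion where
  smul_comm r a b := by
    ext <;> simp only [mul_def, smul_def, smul_eq_mul] <;> ring

lemma eq_sum_basis (p : Octonion) : p = p.c0 • (1 : Octonion) + p.c1 • e 1 + p.c2 • e 2 +
    p.c3 • e 3 + p.c4 • e 4 + p.c5 • e 5 + p.c6 • e 6 + p.c7 • e 7 := by
  ext <;> simp [add_def, smul_def, one_def, e_one_def, e_two_def, e_three_def, e_four_def,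
    e_five_def, e_six_def, e_seven_def]

lemma mul_self_of_imag {p : Octonion} (hp : p.c0 = 0) : p * p =
    -(p.c1 ^ 2 + p.c2 ^ 2 + p.c3 ^ 2 + p.c4 ^ 2 + p.c5 ^ 2 + p.c6 ^ 2 + p.c7 ^ 2) •
      (1 : Octonion) := by
  ext <;> simp only [mul_def, smul_def, one_def, hp] <;> ring

lemma mul_add_mul_of_imag {p q : Octonion} (hp : p.c0 = 0) (hq : q.c0 = 0)
    (h : p.c1 * q.c1 + p.c2 * q.c2 + p.c3 * q.c3 + p.c4 * q.c4 + p.c5 * q.c5 + p.c6 * q.c6 +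
      p.c7 * q.c7 = 0) : p * q + q * p = 0 := by
  ext <;> simp only [mul_def, add_def, zero_c0, zero_c1, zero_c2, zero_c3, zero_c4, zero_c5,
    zero_c6, zero_c7, hp, hq] <;> first | linear_combination -2 * h | ring

lemma e_mul_self {i : Fin 8} (hi : i ≠ 0) : e i * e i = -1 := by
  have h0 : (e i).c0 = 0 := by fin_cases i <;> simp [e] at hi ⊢
  rw [mul_self_of_imag h0, neg_smul]
  congr 1
  convert one_smul ℝ (1 : Octonion)
  fin_cases i <;> simp [e] at hi ⊢

lemma e_mul_add_mul {i j : Fin 8} (hi : i ≠ 0) (hj : j ≠ 0) (hij : i ≠ j) :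
    e i * e j + e j * e i = 0 := by
  apply mul_add_mul_of_imag
  · fin_cases i <;> simp [e] at hi ⊢
  · fin_cases j <;> simp [e] at hj ⊢
  · fin_cases i <;> fin_cases j <;> simp [e] at hi hj hij ⊢

/-- An additive and homogeneous predicate that holds for `1` and the imaginary units holds for all
octonions. -/
lemma basis_induction {P : Octonion → Prop} (hadd : ∀ p q, P p → P q → P (p + q))
    (hsmul : ∀ (r : ℝ) p, P p → P (r • p)) (h0 : P 1)
    (h : ∀ i : Fin 7, P (e i.succ)) (p : Octonion) : P p := by
  rw [eq_sum_basis p]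
  exact hadd _ _ (hadd _ _ (hadd _ _ (hadd _ _ (hadd _ _ (hadd _ _ (hadd _ _
    (hsmul _ _ h0) (hsmul _ _ (h 0))) (hsmul _ _ (h 1))) (hsmul _ _ (h 2))) (hsmul _ _ (h 3)))
    (hsmul _ _ (h 4))) (hsmul _ _ (h 5))) (hsmul _ _ (h 6))

end Octonion
lemma eq_of_add_self_eq {M : Type*} [AddCommGroup M] [Module ℝ M] {x y : M} (h : x + x = y + y) : x = y := by
  have h2 : (2 : ℝ) • (x - y) = 0 := by
    linear_combination (norm := module) h
  exact sub_eq_zero.1 ((smul_eq_zero.1 h2).resolve_left two_ne_zero)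

/-! ### Clifford relations between right and left multiplications. -/

section Multiplications

open Octonion OctBimodule

variable {M : Type*} [AddCommGroup M] [Module ℝ M] [OctBimodule M]

lemma rmul_rmul_add_rmul_rmul (x : M) (p q : Octonion) :
    rmul (rmul x p) q + rmul (rmul x q) p = rmul x (p * q + q * p) := by
  rw [map_add]
  linear_combination (norm := module) assoc_right_alt x p q

lemma rmul_lmul_sub (x : M) (p q : Octonion) :
    rmul (lmul q x) p = lmul q (rmul x p) + rmul (rmul x p) q - rmul x (p * q) := by
  linear_combination (norm := module) assoc_middle_eq_right x p q

lemma lmul_lmul_add_lmul_lmul (x : M) (p q : Octonion) :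
    lmul p (lmul q x) + lmul q (lmul p x) = lmul (p * q + q * p) x := by
  rw [map_add, LinearMap.add_apply]
  linear_combination (norm := module) -assoc_left_alt x p q

lemma rmul_rmul_e_self {i : Fin 8} (hi : i ≠ 0) (x : M) : rmul (rmul x (e i)) (e i) = -x := by
  apply eq_of_add_self_eq
  rw [rmul_rmul_add_rmul_rmul, e_mul_self hi, map_add, map_neg, rmul_one]

lemma lmul_lmul_e_self {i : Fin 8} (hi : i ≠ 0) (x : M) : lmul (e i) (lmul (e i) x) = -x := by
  apply eq_of_add_self_eq
  rw [lmul_lmul_add_lmul_lmul, e_mul_self hi, map_add, map_neg, LinearMap.add_apply,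
    LinearMap.neg_apply, one_lmul]

lemma rmul_rmul_e_anticomm {i j : Fin 8} (hj : j ≠ 0) (hij : j < i) (x : M) :
    rmul (rmul x (e i)) (e j) = -rmul (rmul x (e j)) (e i) := by
  apply eq_neg_of_add_eq_zero_left
  rw [rmul_rmul_add_rmul_rmul, e_mul_add_mul ((Fin.zero_le j).trans_lt hij).ne' hj hij.ne',
    map_zero]

/-- The difference of left multiplication by `e₁` and an element of the algebra of right
multiplications; it vanishes, see `leftDefect_eq_zero`. -/
noncomputable def leftDefect : M →ₗ[ℝ] M :=
  lmul (e 1) + (1 / 2 : ℝ) • (rmul.flip (e 1) + rmul.flip (e 2) ∘ₗ rmul.flip (e 3)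
    + rmul.flip (e 4) ∘ₗ rmul.flip (e 5) + rmul.flip (e 7) ∘ₗ rmul.flip (e 6))

lemma leftDefect_apply (x : M) : leftDefect x = lmul (e 1) x + (1 / 2 : ℝ) • (rmul x (e 1) +
    rmul (rmul x (e 3)) (e 2) + rmul (rmul x (e 5)) (e 4) + rmul (rmul x (e 6)) (e 7)) := rfl

/-- By `rmul_lmul_sub` the commutator of left multiplication by `e₁` with a right multiplication
involves right multiplications only. The polynomial in `leftDefect` is chosen to have the opposite
commutator. -/
lemma leftDefect_rmul {i : Fin 8} (hi : i ≠ 0) (x : M) :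
    leftDefect (rmul x (e i)) = rmul (leftDefect x) (e i) := by
  have h1 : e 1 * e 1 = -1 := e_mul_self (by decide)
  have h2 : e 2 * e 1 = -e 3 := by ext <;> norm_num [mul_def, neg_def, e_one_def, e_two_def, e_three_def,
    e_four_def, e_five_def, e_six_def, e_seven_def]
  have h3 : e 3 * e 1 = e 2 := by ext <;> norm_num [mul_def, neg_def, e_one_def, e_two_def, e_three_def,
    e_four_def, e_five_def, e_six_def, e_seven_def]
  have h4 : e 4 * e 1 = -e 5 := by ext <;> norm_num [mul_def, neg_def, e_one_def, e_two_def, e_three_def,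
    e_four_def, e_five_def, e_six_def, e_seven_def]
  have h5 : e 5 * e 1 = e 4 := by ext <;> norm_num [mul_def, neg_def, e_one_def, e_two_def, e_three_def,
    e_four_def, e_five_def, e_six_def, e_seven_def]
  have h6 : e 6 * e 1 = e 7 := by ext <;> norm_num [mul_def, neg_def, e_one_def, e_two_def, e_three_def,
    e_four_def, e_five_def, e_six_def, e_seven_def]
  have h7 : e 7 * e 1 = -e 6 := by ext <;> norm_num [mul_def, neg_def, e_one_def, e_two_def, e_three_def,
    e_four_def, e_five_def, e_six_def, e_seven_def]
  simp only [leftDefect_apply, map_add, map_smul, LinearMap.add_apply, LinearMap.smul_apply,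
    rmul_lmul_sub]
  match i with
  | 0 => exact absurd rfl hi
  | 1 | 2 | 3 | 4 | 5 | 6 | 7 =>
    simp only [h1, h2, h3, h4, h5, h6, h7, rmul_rmul_e_self, rmul_rmul_e_anticomm, map_neg,
      rmul_one, LinearMap.neg_apply, ne_eq, Fin.reduceEq, not_false_eq_true, Fin.reduceLT]
    module

/-- Write `D` for the defect, `Rᵢ` for right multiplication by `eᵢ`. Substituting `D` into `(e₁ ·)²
= -1` gives a relation between `D²`, products of `D` with Clifford elements, and Clifford elements.
As `D` commutes with every `Rᵢ`, conjugation by Clifford elements only changes signs in it. -/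
lemma leftDefect_eq_zero : leftDefect (M := M) = 0 := by
  have h2 (y : M) : lmul (e 1) y = leftDefect y - (1 / 2 : ℝ) • (rmul y (e 1) +
    rmul (rmul y (e 3)) (e 2) + rmul (rmul y (e 5)) (e 4) + rmul (rmul y (e 6)) (e 7)) := by
    rw [leftDefect_apply]; module
  have key (x : M) : leftDefect (leftDefect x) - (rmul (leftDefect x) (e 1)
      + rmul (rmul (leftDefect x) (e 3)) (e 2) + rmul (rmul (leftDefect x) (e 5)) (e 4)
      + rmul (rmul (leftDefect x) (e 6)) (e 7)) =
      (1 / 2 : ℝ) • (rmul (rmul (rmul x (e 1)) (e 2)) (e 3) + rmul (rmul (rmul x (e 1)) (e 4)) (e 5)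
      - rmul (rmul (rmul x (e 1)) (e 6)) (e 7) - rmul (rmul (rmul (rmul x (e 2)) (e 3)) (e 4)) (e 5)
      + rmul (rmul (rmul (rmul x (e 2)) (e 3)) (e 6)) (e 7)
      + rmul (rmul (rmul (rmul x (e 4)) (e 5)) (e 6)) (e 7)) := by
    have h := lmul_lmul_e_self (i := 1) (by decide) x
    simp only [h2, map_sub, map_add, map_smul, LinearMap.sub_apply, LinearMap.add_apply,
      LinearMap.smul_apply, leftDefect_rmul, rmul_rmul_e_self, rmul_rmul_e_anticomm, map_neg,
      neg_neg,
      LinearMap.neg_apply, ne_eq, Fin.reduceEq, not_false_eq_true, Fin.reduceLT] at h ⊢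
    linear_combination (norm := module) h
  ext x
  have k1 := key x
  have k2 := congr(rmul (rmul $(key (rmul (rmul x (e 2)) (e 4))) (e 2)) (e 4))
  have k3 := congr(rmul (rmul $(key (rmul (rmul x (e 2)) (e 6))) (e 2)) (e 6))
  have k4 := congr(rmul (rmul $(key (rmul (rmul x (e 4)) (e 6))) (e 4)) (e 6))
  have k5 := congr(rmul $(key (rmul x (e 2))) (e 2))
  have k6 := congr(rmul $(key (rmul x (e 4))) (e 4))
  have k7 := congr(rmul $(key (rmul x (e 6))) (e 6))
  have k8 := congr(rmul (rmul (rmul $(key (rmul (rmul (rmul x (e 2)) (e 4)) (e 6))) (e 2))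
    (e 4)) (e 6))
  -- Signed sum of the conjugates of `key` under the group generated by `R₂, R₄, R₆`, with sign
  -- given by parity. Only a term anticommuting with all three generators survives, and `D R₁` is
  -- the only such term.
  have k : (8 : ℝ) • rmul (leftDefect x) (e 1) = 0 := by
    clear h2 key
    simp only [map_sub, map_add, map_smul, LinearMap.sub_apply, LinearMap.add_apply,
      LinearMap.smul_apply, leftDefect_rmul, rmul_rmul_e_self, rmul_rmul_e_anticomm, map_neg,
      neg_neg,
      LinearMap.neg_apply, ne_eq, Fin.reduceEq, not_false_eq_true, Fin.reduceLT]
      at k1 k2 k3 k4 k5 k6 k7 k8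
    linear_combination (norm := module) -k1 + k2 + k3 + k4 - k5 - k6 - k7 + k8
  have h3 := rmul_rmul_e_self (i := 1) (by decide) (leftDefect x)
  rw [(smul_eq_zero.1 k).resolve_left (by norm_num), map_zero, LinearMap.zero_apply, eq_comm,
    neg_eq_zero] at h3
  simpa using h3

lemma lmul_e_one (x : M) : lmul (e 1) x = (-1 / 2 : ℝ) • (rmul x (e 1) +
    rmul (rmul x (e 3)) (e 2) + rmul (rmul x (e 5)) (e 4) + rmul (rmul x (e 6)) (e 7)) := by
  have h := leftDefect_apply x
  rw [leftDefect_eq_zero, LinearMap.zero_apply] at h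
  linear_combination (norm := module) -h

/-- The product of all seven imaginary right multiplications is a scalar. -/
lemma rmul_volume (x : M) : rmul (rmul (rmul (rmul (rmul (rmul (rmul x (e 1)) (e 2)) (e 3))
    (e 4)) (e 5)) (e 6)) (e 7) = -x := by
  -- Now `(e₁ ·)² = -1` is a relation between right multiplications alone. Comparison with its
  -- conjugate by `e₂` isolates the products of `e₁e₂e₃` and of `e₄e₅e₆e₇`; multiplying by `e₁e₂e₃`
  -- gives the volume element.
  have key (x : M) : lmul (e 1) (lmul (e 1) x) = -x := lmul_lmul_e_self (by decide) x
  have k1 := congr(rmul (rmul (rmul $(key x) (e 1)) (e 2)) (e 3))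
  have k2 := congr(rmul (rmul (rmul (rmul $(key (rmul x (e 2))) (e 2)) (e 1)) (e 2)) (e 3))
  simp only [lmul_e_one, map_add, map_smul, LinearMap.add_apply,
      LinearMap.smul_apply, rmul_rmul_e_self, rmul_rmul_e_anticomm, map_neg, neg_neg,
      LinearMap.neg_apply, ne_eq, Fin.reduceEq, not_false_eq_true, Fin.reduceLT]
      at k1 k2
  linear_combination (norm := module) k2 - k1

end Multiplications

/-! ### The real part of a bimodule and generation by it. -/

section BimoduleStructure

open Octonion OctBimodule

variable {M : Type*} [AddCommGroup M] [Module ℝ M] [OctBimodule M]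

/-- The projection onto the real part, as an element of the algebra of right multiplications. -/
noncomputable def rightRealProj (x : M) : M :=
  (1 / 8 : ℝ) • (x - rmul (rmul (rmul x (e 1)) (e 2)) (e 3)
     - rmul (rmul (rmul x (e 1)) (e 4)) (e 5)
     + rmul (rmul (rmul x (e 1)) (e 6)) (e 7)
     - rmul (rmul (rmul x (e 2)) (e 4)) (e 6)
     - rmul (rmul (rmul x (e 2)) (e 5)) (e 7)
     - rmul (rmul (rmul x (e 3)) (e 4)) (e 7)
     + rmul (rmul (rmul x (e 3)) (e 5)) (e 6))

/-- The seven oriented lines of the Fano plane act on a real part by the scalar `-1`. -/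
lemma rmul_line_rightRealProj (x : M) :
    rmul (rmul (rmul (rightRealProj x) (e 1)) (e 2)) (e 3) = -rightRealProj x ∧
    rmul (rmul (rmul (rightRealProj x) (e 1)) (e 4)) (e 5) = -rightRealProj x ∧
    rmul (rmul (rmul (rightRealProj x) (e 1)) (e 6)) (e 7) = rightRealProj x ∧
    rmul (rmul (rmul (rightRealProj x) (e 2)) (e 4)) (e 6) = -rightRealProj x ∧
    rmul (rmul (rmul (rightRealProj x) (e 2)) (e 5)) (e 7) = -rightRealProj x ∧
    rmul (rmul (rmul (rightRealProj x) (e 3)) (e 4)) (e 7) = -rightRealProj x ∧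
    rmul (rmul (rmul (rightRealProj x) (e 3)) (e 5)) (e 6) = rightRealProj x := by
  -- The product of two lines is, up to sign, a product of four units, and the volume relation turns
  -- this into the complementary line. Hence each line product permutes the eight terms of
  -- `rightRealProj` up to sign. The signs for `167` and `356` differ because the oriented triples
  -- are `176` and `365`.
  have h1 := rmul_volume (rmul (rmul (rmul x (e 1)) (e 2)) (e 3))
  have h2 := rmul_volume (rmul (rmul (rmul x (e 1)) (e 4)) (e 5))
  have h3 := rmul_volume (rmul (rmul (rmul x (e 1)) (e 6)) (e 7))
  have h4 := rmul_volume (rmul (rmul (rmul x (e 2)) (e 4)) (e 6))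
  have h5 := rmul_volume (rmul (rmul (rmul x (e 2)) (e 5)) (e 7))
  have h6 := rmul_volume (rmul (rmul (rmul x (e 3)) (e 4)) (e 7))
  have h7 := rmul_volume (rmul (rmul (rmul x (e 3)) (e 5)) (e 6))
  simp only [rmul_rmul_e_self, rmul_rmul_e_anticomm, map_neg, neg_neg,
    LinearMap.neg_apply, ne_eq, Fin.reduceEq, not_false_eq_true, Fin.reduceLT]
    at h1 h2 h3 h4 h5 h6 h7
  refine ⟨?_, ?_, ?_, ?_, ?_, ?_, ?_⟩
  all_goals
    simp only [rightRealProj, map_add, map_sub, map_smul, LinearMap.add_apply, LinearMap.sub_apply,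
    LinearMap.smul_apply, rmul_rmul_e_self, rmul_rmul_e_anticomm, map_neg, neg_neg,
    LinearMap.neg_apply, ne_eq, Fin.reduceEq, not_false_eq_true, Fin.reduceLT, h1, h2, h3, h4, h5, h6, h7]
    module

lemma rmul_rmul_rightRealProj (x : M) (p q : Octonion) :
    rmul (rmul (rightRealProj x) p) q = rmul (rightRealProj x) (p * q) := by
  obtain ⟨h1, h2, h3, h4, h5, h6, h7⟩ := rmul_line_rightRealProj x
  generalize rightRealProj x = y at *
  -- Cancelling one unit of a line expresses a product of the other two as a single right
  -- multiplication; the 21 relations give the whole multiplication table.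
  have k23 := congr(rmul $h1 (e 1))
  have k13 := congr(rmul $h1 (e 2))
  have k12 := congr(rmul $h1 (e 3))
  have k45 := congr(rmul $h2 (e 1))
  have k15 := congr(rmul $h2 (e 4))
  have k14 := congr(rmul $h2 (e 5))
  have k67 := congr(rmul $h3 (e 1))
  have k17 := congr(rmul $h3 (e 6))
  have k16 := congr(rmul $h3 (e 7))
  have k46 := congr(rmul $h4 (e 2))
  have k26 := congr(rmul $h4 (e 4))
  have k24 := congr(rmul $h4 (e 6))
  have k57 := congr(rmul $h5 (e 2))
  have k27 := congr(rmul $h5 (e 5))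
  have k25 := congr(rmul $h5 (e 7))
  have k47 := congr(rmul $h6 (e 3))
  have k37 := congr(rmul $h6 (e 4))
  have k34 := congr(rmul $h6 (e 7))
  have k56 := congr(rmul $h7 (e 3))
  have k36 := congr(rmul $h7 (e 5))
  have k35 := congr(rmul $h7 (e 6))
  simp only [rmul_rmul_e_self, rmul_rmul_e_anticomm, map_neg, neg_neg,
    LinearMap.neg_apply, ne_eq, Fin.reduceEq, not_false_eq_true, Fin.reduceLT, neg_eq_iff_eq_neg]
    at k23 k13 k12 k45 k15 k14 k67 k17 k16 k46 k26 k24 k57 k27 k25 k47 k37 k34 k56 k36 k35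
  rw [eq_sum_basis (p * q)]
  conv_lhs => rw [eq_sum_basis p, eq_sum_basis q]
  simp only [map_add, map_smul, LinearMap.add_apply, LinearMap.smul_apply, rmul_one,
    rmul_rmul_e_self, rmul_rmul_e_anticomm, ne_eq, Fin.reduceEq, not_false_eq_true, Fin.reduceLT,
    neg_neg, k23, k13, k12, k45, k15, k14, k67, k17, k16, k46, k26,
    k24, k57, k27, k25, k47, k37, k34, k56, k36, k35, mul_def]
  module

lemma rightRealProj_mem (x : M) : rightRealProj x ∈ octRe M := fun p q => by
  rw [assoc_left_eq_middle, assoc_middle_eq_right, rmul_rmul_rightRealProj, sub_self]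

/-- A line product commutes with the identity and with its own three units, and anticommutes with
the four others. In the sum of the eight conjugates of the projection all line products therefore
cancel. -/
lemma sum_rmul_rightRealProj (x : M) :
    x = rightRealProj x - rmul (rightRealProj (rmul x (e 1))) (e 1) - rmul (rightRealProj (rmul x (e 2))) (e 2) - rmul (rightRealProj (rmul x (e 3))) (e 3) - rmul (rightRealProj (rmul x (e 4))) (e 4) - rmul (rightRealProj (rmul x (e 5))) (e 5) - rmul (rightRealProj (rmul x (e 6))) (e 6) - rmul (rightRealProj (rmul x (e 7))) (e 7) := by
  simp only [rightRealProj, map_add, map_sub, map_smul, LinearMap.add_apply, LinearMap.sub_apply,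
    LinearMap.smul_apply, rmul_rmul_e_self, rmul_rmul_e_anticomm, map_neg, neg_neg,
    LinearMap.neg_apply, ne_eq, Fin.reduceEq, not_false_eq_true, Fin.reduceLT]
  module

section Nucleus

variable {v : M}

lemma rmul_rmul_of_mem (hv : v ∈ octRe M) (p q : Octonion) :
    rmul (rmul v p) q = rmul v (p * q) := by
  rw [← sub_eq_zero, ← assoc_middle_eq_right, ← assoc_left_eq_middle]
  exact hv p q

lemma rmul_lmul_of_mem (hv : v ∈ octRe M) (p q : Octonion) :
    rmul (lmul q v) p = lmul q (rmul v p) := by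
  rw [← sub_eq_zero, ← assoc_left_eq_middle]
  exact hv p q

lemma lmul_lmul_of_mem (hv : v ∈ octRe M) (p q : Octonion) :
    lmul p (lmul q v) = lmul (p * q) v :=
  (sub_eq_zero.1 (hv p q)).symm

/-- Since `v` is nuclear it can be moved through the associator: `[a, b, cv] = [b, cv, a] = [b, c,
va] = [va, b, c]`, whose ends are `[a, b, c] v` and `v [a, b, c]`. -/
lemma associator_comm_of_mem (hv : v ∈ octRe M) (a b c : Octonion) :
    lmul (a * b * c - a * (b * c)) v = rmul v (a * b * c - a * (b * c)) := by
  have h1 := assoc_left_eq_middle (lmul c v) a b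
  have h2 := assoc_left_eq_middle (rmul v a) b c
  have h3 := assoc_middle_eq_right (rmul v a) b c
  rw [lmul_lmul_of_mem hv, lmul_lmul_of_mem hv b c, lmul_lmul_of_mem hv,
    rmul_lmul_of_mem hv, rmul_lmul_of_mem hv, h2, h3, rmul_rmul_of_mem hv, rmul_rmul_of_mem hv,
    rmul_rmul_of_mem hv] at h1
  rw [map_sub, LinearMap.sub_apply, map_sub, h1]

/-- Associators span the imaginary octonions. This makes the nucleus central, and later makes real
vectors orthogonal to imaginary multiples of real vectors. -/
lemma two_smul_e_eq_associator (i : Fin 7) :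
    ∃ a b c : Octonion, (2 : ℝ) • e i.succ = a * b * c - a * (b * c) := by
  match i with
  | 0 =>
    refine ⟨e 2, e 5, e 6, ?_⟩
    change (2 : ℝ) • e 1 = _
    ext <;> norm_num [mul_def, sub_def, smul_def, e_one_def, e_two_def, e_five_def, e_six_def]
  | 1 =>
    refine ⟨e 1, e 4, e 7, ?_⟩
    change (2 : ℝ) • e 2 = _
    ext <;> norm_num [mul_def, sub_def, smul_def, e_one_def, e_two_def, e_four_def, e_seven_def]
  | 2 =>
    refine ⟨e 1, e 6, e 4, ?_⟩
    change (2 : ℝ) • e 3 = _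
    ext <;> norm_num [mul_def, sub_def, smul_def, e_one_def, e_three_def, e_four_def, e_six_def]
  | 3 =>
    refine ⟨e 1, e 3, e 6, ?_⟩
    change (2 : ℝ) • e 4 = _
    ext <;> norm_num [mul_def, sub_def, smul_def, e_one_def, e_three_def, e_four_def, e_six_def]
  | 4 =>
    refine ⟨e 1, e 2, e 6, ?_⟩
    change (2 : ℝ) • e 5 = _
    ext <;> norm_num [mul_def, sub_def, smul_def, e_one_def, e_two_def, e_five_def, e_six_def]
  | 5 =>
    refine ⟨e 1, e 4, e 3, ?_⟩
    change (2 : ℝ) • e 6 = _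
    ext <;> norm_num [mul_def, sub_def, smul_def, e_one_def, e_three_def, e_four_def, e_six_def]
  | 6 =>
    refine ⟨e 1, e 2, e 4, ?_⟩
    change (2 : ℝ) • e 7 = _
    ext <;> norm_num [mul_def, sub_def, smul_def, e_one_def, e_two_def, e_four_def, e_seven_def]

/-- The nucleus of an octonion bimodule is contained in its centre. -/
lemma lmul_of_mem (hv : v ∈ octRe M) (p : Octonion) : lmul p v = rmul v p := by
  induction p using basis_induction with
  | hadd p q hp hq => rw [map_add, LinearMap.add_apply, map_add, hp, hq]
  | hsmul r p hp => rw [map_smul, LinearMap.smul_apply, map_smul, hp]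
  | h0 => rw [one_lmul, rmul_one]
  | h i =>
    obtain ⟨a, b, c, h⟩ := two_smul_e_eq_associator i
    have h2 := associator_comm_of_mem hv a b c
    rw [← h, map_smul, LinearMap.smul_apply, map_smul] at h2
    exact smul_right_injective M (two_ne_zero (α := ℝ)) h2

lemma lmul_rmul_of_mem (hv : v ∈ octRe M) (p q : Octonion) :
    lmul p (rmul v q) = rmul v (p * q) := by
  rw [← rmul_lmul_of_mem hv, lmul_of_mem hv, rmul_rmul_of_mem hv]

/-- In `𝕆`, `∑ eᵢ q eᵢ` is `-7` for `q = 1` and `5 q` for an imaginary unit `q` (six summands `q`,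
one `-q`), whence the constants `5/12` and `1/12`. -/
lemma octRePart_rmul_of_mem (hv : v ∈ octRe M) (q : Octonion) :
    octRePart (rmul v q) = q.c0 • v := by
  have h : (5 / 12 : ℝ) • q - (1 / 12 : ℝ) • ∑ i : Fin 7, e i.succ * q * e i.succ =
      q.c0 • (1 : Octonion) := by
    rw [show ∑ i : Fin 7, e i.succ * q * e i.succ = e 1 * q * e 1 + e 2 * q * e 2 +
      e 3 * q * e 3 + e 4 * q * e 4 + e 5 * q * e 5 + e 6 * q * e 6 + e 7 * q * e 7 from
      Fin.sum_univ_seven _]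
    ext <;> simp [mul_def, sub_def, add_def, smul_def, one_def, e_one_def, e_two_def, e_three_def,
      e_four_def, e_five_def, e_six_def, e_seven_def] <;> ring
  have h2 : octRePart (rmul v q) = rmul v ((5 / 12 : ℝ) • q -
      (1 / 12 : ℝ) • ∑ i : Fin 7, e i.succ * q * e i.succ) := by
    simp [octRePart, lmul_rmul_of_mem hv, rmul_rmul_of_mem hv]
  rw [h2, h, map_smul, rmul_one]

lemma octRePart_of_mem (hv : v ∈ octRe M) : octRePart v = v := by
  have h := octRePart_rmul_of_mem hv 1
  rwa [rmul_one, one_def, one_smul] at h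

end Nucleus

/-- The real part of a bimodule as a real subspace. -/
def octReSubmodule (M : Type*) [AddCommGroup M] [Module ℝ M] [OctBimodule M] :
    Submodule ℝ M where
  carrier := octRe M
  add_mem' {u v} hu hv p q := by
    rw [map_add, map_add, map_add]
    linear_combination (norm := module) hu p q + hv p q
  zero_mem' p q := by simp
  smul_mem' r v hv p q := by
    rw [map_smul, map_smul, map_smul, ← smul_sub, hv p q, smul_zero]

@[simp] lemma mem_octReSubmodule {v : M} : v ∈ octReSubmodule M ↔ v ∈ octRe M := Iff.rfl

/-- Every bimodule is spanned by the octonion multiples of its real part. -/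
lemma octRe_induction {P : M → Prop} (hadd : ∀ x y, P x → P y → P (x + y))
    (h : ∀ v ∈ octRe M, ∀ p, P (rmul v p)) (x : M) : P x := by
  have h2 (y : M) (i : Fin 8) : P (rmul (rightRealProj y) (-e i)) := h _ (rightRealProj_mem _) _
  rw [sum_rmul_rightRealProj x]
  simp only [sub_eq_add_neg, ← map_neg]
  refine hadd _ _ (hadd _ _ (hadd _ _ (hadd _ _ (hadd _ _ (hadd _ _ (hadd _ _ ?_
    (h2 _ _)) (h2 _ _)) (h2 _ _)) (h2 _ _)) (h2 _ _)) (h2 _ _)) (h2 _ _)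
  rw [← rmul_one (rightRealProj x)]
  exact h _ (rightRealProj_mem _) _

end BimoduleStructure

/-! ### Para-linear maps, their octonion multiples and regular composition. -/

section ParaLinear

open Octonion OctBimodule

variable {M : Type*} [AddCommGroup M] [Module ℝ M] [OctBimodule M]

lemma Octonion.sum_mul_conj_e (a : Octonion) : ∑ i, (a * (e i).conj).c0 • e i = a := by
  rw [Fin.sum_univ_eight]
  ext <;> simp [mul_def, add_def, smul_def, e_zero, one_def, e_one_def, e_two_def, e_three_def,
      e_four_def, e_five_def, e_six_def, e_seven_def, conj]

lemma Octonion.re_mul_mul (a b c : Octonion) : (a * b * c).c0 = (a * (b * c)).c0 := by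
  simp only [mul_def]; ring

lemma Octonion.re_mul_comm (a b : Octonion) : (a * b).c0 = (b * a).c0 := by
  simp only [mul_def]; ring

set_option maxHeartbeats 2000000 in
lemma Octonion.moufang_middle (p a b : Octonion) : p * a * (b * p) = p * (a * b) * p := by
  ext <;> simp only [mul_def] <;> ring

set_option maxHeartbeats 2000000 in
lemma Octonion.moufang_right (p a b : Octonion) : a * (p * b * p) = a * p * b * p := by
  ext <;> simp only [mul_def] <;> ring

lemma Octonion.mul_mul_conj_self (a p : Octonion) :
    a * p * p.conj = (p * p.conj).c0 • a := by
  ext <;> simp only [mul_def, conj, smul_def] <;> ring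

lemma Octonion.mul_conj_mul_self (a p : Octonion) :
    a * p.conj * p = (p * p.conj).c0 • a := by
  ext <;> simp only [mul_def, conj, smul_def] <;> ring

lemma Octonion.e_mul_conj_re (i : Fin 8) : (e i * (e i).conj).c0 = 1 := by
  fin_cases i <;> norm_num [mul_def, conj, e]

lemma octRePart_mem (x : M) : octRePart x ∈ octRe M := by
  induction x using octRe_induction with
  | hadd x y hx hy => rw [map_add]; exact (octReSubmodule M).add_mem hx hy
  | h v hv p => rw [octRePart_rmul_of_mem hv]; exact (octReSubmodule M).smul_mem _ hv

lemma mem_octRe_iff {x : M} : x ∈ octRe M ↔ octRePart x = x :=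
  ⟨octRePart_of_mem, fun h => h ▸ octRePart_mem x⟩

lemma octRePart_rmul_rmul (x : M) (p q : Octonion) :
    octRePart (rmul (rmul x p) q) = octRePart (rmul x (p * q)) := by
  induction x using octRe_induction with
  | hadd x y hx hy => simp only [map_add, LinearMap.add_apply, hx, hy]
  | h v hv a => simp only [rmul_rmul_of_mem hv, octRePart_rmul_of_mem hv, re_mul_mul]

lemma octRePart_lmul (x : M) (p : Octonion) :
    octRePart (lmul p x) = octRePart (rmul x p) := by
  induction x using octRe_induction with
  | hadd x y hx hy => simp only [map_add, LinearMap.add_apply, hx, hy]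
  | h v hv a => rw [lmul_rmul_of_mem hv, rmul_rmul_of_mem hv, octRePart_rmul_of_mem hv,
      octRePart_rmul_of_mem hv, re_mul_comm]

lemma sum_rmul_octRePart (x : M) :
    ∑ i, rmul (octRePart (rmul x (e i).conj)) (e i) = x := by
  induction x using octRe_induction with
  | hadd x y hx hy => simp only [map_add, LinearMap.add_apply, Finset.sum_add_distrib, hx, hy]
  | h v hv a =>
    simp only [rmul_rmul_of_mem hv, octRePart_rmul_of_mem hv, map_smul, LinearMap.smul_apply]
    conv_rhs => rw [← sum_mul_conj_e a]
    simp only [map_sum, map_smul]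

lemma eq_of_octRePart_rmul_eq {x y : M} (h : ∀ p, octRePart (rmul x p) = octRePart (rmul y p)) :
    x = y := by
  rw [← sum_rmul_octRePart x, ← sum_rmul_octRePart y]
  simp only [h]

lemma octB_apply (p : Octonion) (f : M →ₗ[ℝ] M) (x : M) :
    octB p f x = rmul (f x) p - f (rmul x p) := rfl

lemma octLSmul_apply (p : Octonion) (f : M →ₗ[ℝ] M) (x : M) :
    octLSmul p f x = lmul p (f x) + (rmul (f x) p - f (rmul x p)) := rfl

lemma octRSmul_apply (f : M →ₗ[ℝ] M) (p : Octonion) (x : M) :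
    octRSmul f p x = f (lmul p x) - (rmul (f x) p - f (rmul x p)) := rfl

lemma octComp_apply (f g : M →ₗ[ℝ] M) (x : M) :
    octComp f g x = ∑ i, lmul (e i) (octRePart (f (g (rmul x (e i).conj)))) := by
  simp [octComp]

/-- Para-linear maps are the maps that are right linear on the real part. -/
lemma isParaLinear_iff {f : M →ₗ[ℝ] M} :
    IsParaLinear f ↔ ∀ v ∈ octRe M, ∀ p, f (rmul v p) = rmul (f v) p := by
  refine ⟨fun hf v hv p => ?_, fun hf p x => ?_⟩
  · have h (q : Octonion) (x : M) : octRePart (rmul (f x) q) = octRePart (f (rmul x q)) := by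
      have := hf q x
      rwa [octB_apply, map_sub, sub_eq_zero] at this
    refine eq_of_octRePart_rmul_eq fun q => ?_
    rw [h, rmul_rmul_of_mem hv, octRePart_rmul_rmul, h]
  · induction x using octRe_induction with
    | hadd x y hx hy => rw [map_add, map_add, hx, hy, add_zero]
    | h v hv q =>
      rw [octB_apply, rmul_rmul_of_mem hv, hf v hv, hf v hv, map_sub, octRePart_rmul_rmul, sub_self]

namespace IsParaLinear

variable {f g : M →ₗ[ℝ] M}

lemma map_rmul (hf : IsParaLinear f) {v : M} (hv : v ∈ octRe M) (p : Octonion) :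
    f (rmul v p) = rmul (f v) p :=
  isParaLinear_iff.1 hf v hv p

lemma map_lmul (hf : IsParaLinear f) {v : M} (hv : v ∈ octRe M) (p : Octonion) :
    f (lmul p v) = rmul (f v) p := by
  rw [lmul_of_mem hv, hf.map_rmul hv]

lemma octRePart_map_rmul (hf : IsParaLinear f) (x : M) (p : Octonion) :
    octRePart (f (rmul x p)) = octRePart (rmul (f x) p) := by
  have := hf p x
  rw [octB_apply, map_sub, sub_eq_zero] at this
  exact this.symm

lemma ext (hf : IsParaLinear f) (hg : IsParaLinear g) (h : ∀ v ∈ octRe M, f v = g v) : f = g := by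
  ext x
  induction x using octRe_induction with
  | hadd x y hx hy => rw [map_add, map_add, hx, hy]
  | h v hv p => rw [hf.map_rmul hv, hg.map_rmul hv, h v hv]

lemma smul (hf : IsParaLinear f) (r : ℝ) : IsParaLinear (r • f) :=
  isParaLinear_iff.2 fun v hv p => by
    simp only [LinearMap.smul_apply, hf.map_rmul hv, map_smul]

lemma sub (hf : IsParaLinear f) (hg : IsParaLinear g) : IsParaLinear (f - g) :=
  isParaLinear_iff.2 fun v hv p => by
    simp only [LinearMap.sub_apply, hf.map_rmul hv, hg.map_rmul hv, map_sub]

lemma sum {ι : Type*} {s : Finset ι} {f : ι → M →ₗ[ℝ] M} (hf : ∀ i ∈ s, IsParaLinear (f i)) :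
    IsParaLinear (∑ i ∈ s, f i) :=
  isParaLinear_iff.2 fun v hv p => by
    simp only [LinearMap.sum_apply, map_sum]
    exact Finset.sum_congr rfl fun i hi => (hf i hi).map_rmul hv p

lemma octLSmul_of_mem (hf : IsParaLinear f) (p : Octonion) {v : M} (hv : v ∈ octRe M) :
    octLSmul p f v = lmul p (f v) := by
  rw [octLSmul_apply, hf.map_rmul hv, sub_self, add_zero]

lemma octRSmul_of_mem (hf : IsParaLinear f) (p : Octonion) {v : M} (hv : v ∈ octRe M) :
    octRSmul f p v = rmul (f v) p := by
  rw [octRSmul_apply, hf.map_rmul hv, sub_self, sub_zero, hf.map_lmul hv]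

lemma octLSmul (hf : IsParaLinear f) (p : Octonion) : IsParaLinear (octLSmul p f) :=
  isParaLinear_iff.2 fun v hv q => by
    rw [hf.octLSmul_of_mem p hv, octLSmul_apply, rmul_rmul_of_mem hv, hf.map_rmul hv,
      hf.map_rmul hv, rmul_lmul_sub, add_sub_assoc]

lemma octRSmul (hf : IsParaLinear f) (p : Octonion) : IsParaLinear (octRSmul f p) :=
  isParaLinear_iff.2 fun v hv q => by
    have h := rmul_rmul_add_rmul_rmul (f v) p q
    rw [map_add] at h
    rw [hf.octRSmul_of_mem p hv, octRSmul_apply, rmul_rmul_of_mem hv, hf.map_rmul hv,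
      hf.map_rmul hv, lmul_rmul_of_mem hv, hf.map_rmul hv]
    linear_combination (norm := module) -h

/-- A left multiple of a para-linear map by a basis octonion, through the middle Moufang
identity. -/
lemma octLSmul_e_apply (hf : IsParaLinear f) (i : Fin 8) (x : M) :
    _root_.octLSmul (e i) f x = rmul (lmul (e i) (f (rmul x (e i).conj))) (e i) := by
  induction x using octRe_induction with
  | hadd x y hx hy => simp only [map_add, LinearMap.add_apply, hx, hy]
  | h v hv q =>
    rw [(hf.octLSmul _).map_rmul hv, hf.octLSmul_of_mem _ hv, rmul_rmul_of_mem hv,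
      hf.map_rmul hv]
    generalize f v = y
    induction y using octRe_induction with
    | hadd x y hx hy => simp only [map_add, LinearMap.add_apply, hx, hy]
    | h w hw a =>
      simp only [lmul_rmul_of_mem hw, rmul_rmul_of_mem hw, ← moufang_middle, mul_conj_mul_self,
        e_mul_conj_re, one_smul]

/-- The right Moufang identity, in the role of the middle one for `octLSmul`. Both formulas place
`f` between multiplications by units, which are isometries of a Hilbert bimodule; the convergence
and norm estimates rest on this. -/
lemma octRSmul_e_apply (hf : IsParaLinear f) (i : Fin 8) (x : M) :
    _root_.octRSmul f (e i) x = rmul (f (rmul (lmul (e i) x) (e i))) (e i).conj := by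
  induction x using octRe_induction with
  | hadd x y hx hy => simp only [map_add, LinearMap.add_apply, hx, hy]
  | h v hv q =>
    rw [(hf.octRSmul _).map_rmul hv, hf.octRSmul_of_mem _ hv, lmul_rmul_of_mem hv,
      rmul_rmul_of_mem hv, hf.map_rmul hv]
    generalize f v = y
    induction y using octRe_induction with
    | hadd x y hx hy => simp only [map_add, LinearMap.add_apply, hx, hy]
    | h w hw a =>
      simp only [rmul_rmul_of_mem hw, moufang_right, mul_mul_conj_self,
        e_mul_conj_re, one_smul]

lemma octOpRe (hf : IsParaLinear f) : IsParaLinear (octOpRe f) :=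
  (hf.smul _).sub ((sum fun _ _ => (hf.octLSmul _).octRSmul _).smul _)

lemma octOpRe_of_mem (hf : IsParaLinear f) {v : M} (hv : v ∈ octRe M) :
    _root_.octOpRe f v = octRePart (f v) := by
  simp [_root_.octOpRe, octRePart, (hf.octLSmul _).octRSmul_of_mem _ hv, hf.octLSmul_of_mem _ hv]

/-- The operator real part is para-linear, hence determined on `Re M`, where it is the pointwise
real part. This reduces identities of operator real parts to real vectors. -/
lemma octOpRe_eq (hf : IsParaLinear f) (hg : IsParaLinear g)
    (h : ∀ v ∈ octRe M, octRePart (f v) = octRePart (g v)) :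
    _root_.octOpRe f = _root_.octOpRe g :=
  ext hf.octOpRe hg.octOpRe fun v hv => by
    rw [hf.octOpRe_of_mem hv, hg.octOpRe_of_mem hv, h v hv]

lemma octComp_rmul (hf : IsParaLinear f) (hg : IsParaLinear g) {v : M} (hv : v ∈ octRe M)
    (q : Octonion) : octComp f g (rmul v q) = rmul (f (g v)) q := by
  rw [octComp_apply, ← sum_rmul_octRePart (rmul (f (g v)) q)]
  refine Finset.sum_congr rfl fun i _ => ?_
  rw [lmul_of_mem (octRePart_mem _), rmul_rmul_of_mem hv, hg.map_rmul hv, hf.octRePart_map_rmul,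
    octRePart_rmul_rmul]

lemma octComp_of_mem (hf : IsParaLinear f) (hg : IsParaLinear g) {v : M} (hv : v ∈ octRe M) :
    _root_.octComp f g v = f (g v) := by
  have h := hf.octComp_rmul hg hv 1
  rwa [rmul_one, rmul_one] at h

lemma octComp (hf : IsParaLinear f) (hg : IsParaLinear g) : IsParaLinear (octComp f g) :=
  isParaLinear_iff.2 fun v hv q => by
    rw [octComp_rmul hf hg hv, hf.octComp_of_mem hg hv]

end IsParaLinear

end ParaLinear

/-! ### The inner product, isometries and slices. -/

section HilbertBimodule

open Octonion OctBimodule HilbertOctBimodule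

namespace Octonion

lemma conj_conj (p : Octonion) : p.conj.conj = p := by
  ext <;> simp [conj]

lemma conj_mul (p q : Octonion) : (p * q).conj = q.conj * p.conj := by
  ext <;> simp only [conj, mul_def] <;> ring

lemma conj_one : (1 : Octonion).conj = 1 := by
  ext <;> simp [conj, one_def]

lemma conj_of_imag {p : Octonion} (hp : p.c0 = 0) : p.conj = -p := by
  ext <;> simp [conj, neg_def, hp]

lemma conj_zero : (0 : Octonion).conj = 0 := by
  ext <;> simp [conj]

lemma mul_conj_re (p : Octonion) : (p * p.conj).c0 = p.c0 ^ 2 + p.c1 ^ 2 + p.c2 ^ 2 + p.c3 ^ 2 +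
    p.c4 ^ 2 + p.c5 ^ 2 + p.c6 ^ 2 + p.c7 ^ 2 := by
  simp only [mul_def, conj]; ring

lemma abs_sq (p : Octonion) : p.abs ^ 2 = (p * p.conj).c0 :=
  Real.sq_sqrt (by rw [re, mul_conj_re]; positivity)

lemma abs_nonneg (p : Octonion) : 0 ≤ p.abs := Real.sqrt_nonneg _

lemma abs_e (i : Fin 8) : (e i).abs = 1 := by
  rw [abs, re, e_mul_conj_re, Real.sqrt_one]

lemma abs_conj (p : Octonion) : p.conj.abs = p.abs := by
  simp only [abs, re, mul_conj_re]
  simp [conj]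

lemma abs_conj_e (i : Fin 8) : (e i).conj.abs = 1 := by rw [abs_conj, abs_e]

lemma e_succ_re (i : Fin 7) : (e i.succ).c0 = 0 := by
  fin_cases i <;> rfl

end Octonion

variable {H : Type*} [NormedAddCommGroup H] [InnerProductSpace ℝ H] [HilbertOctBimodule H]

lemma oinner_re (u v : H) : (oinner u v).c0 = inner ℝ u v := by
  have h (x : H) : (oinner x x).c0 = ‖x‖ ^ 2 := by rw [oinner_self]; simp [smul_def, one_def]
  have hs : (oinner u v).c0 = (oinner v u).c0 := by rw [oinner_hermitian]; rfl
  have h1 := h (u + v)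
  have h2 := norm_add_sq_real u v
  simp only [map_add, LinearMap.add_apply, add_def, h] at h1
  linarith

lemma oinner_mul_re (u v : H) (p : Octonion) :
    (oinner u v * p).c0 = inner ℝ u (rmul v p) := by
  have h := oinner_paraLinear u v p
  rw [← oinner_re]
  exact sub_eq_zero.1 h

lemma inner_rmul_left (u v : H) (p : Octonion) :
    inner ℝ (rmul u p) v = inner ℝ u (rmul v p.conj) := by
  rw [real_inner_comm, ← oinner_mul_re, ← oinner_mul_re, oinner_hermitian v u, ← conj_conj p,
    ← conj_mul, conj_conj, re_mul_comm]
  rfl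

lemma oinner_eq_sum (u v : H) :
    oinner u v = ∑ i, inner ℝ u (rmul v (e i).conj) • e i := by
  simp only [← oinner_mul_re, sum_mul_conj_e]

lemma oinner_eq_zero_iff {u v : H} : oinner u v = 0 ↔ ∀ p, inner ℝ u (rmul v p) = 0 := by
  refine ⟨fun h p => ?_, fun h => ?_⟩
  · rw [← oinner_mul_re, h, zero_mul, zero_c0]
  · rw [oinner_eq_sum]
    simp [h]

lemma oinner_eq_zero_comm {u v : H} : oinner u v = 0 ↔ oinner v u = 0 := by
  rw [oinner_hermitian u v]
  refine ⟨fun h => ?_, fun h => by rw [h, conj_zero]⟩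
  rw [← conj_conj (oinner v u), h, conj_zero]

/-- The functional `q ↦ ⟨v, w q⟩` vanishes on associators, since multiplications can be moved across
the inner product and associate on both `v` and `w`. Associators span the imaginary octonions. -/
lemma inner_rmul_of_mem {v w : H} (hw : w ∈ octRe H) (hv : v ∈ octRe H) (q : Octonion) :
    inner ℝ v (rmul w q) = q.c0 * inner ℝ v w := by
  have hassoc (a b c : Octonion) :
      inner ℝ v (rmul w (a * b * c)) = inner ℝ v (rmul w (a * (b * c))) := by
    rw [← rmul_rmul_of_mem hw, ← rmul_rmul_of_mem hw, ← conj_conj c, ← inner_rmul_left,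
      ← conj_conj b, ← inner_rmul_left, ← conj_conj a, ← inner_rmul_left,
      rmul_rmul_of_mem hv, rmul_rmul_of_mem hv, inner_rmul_left]
    simp only [conj_mul, conj_conj]
  induction q using basis_induction with
  | hadd p q hp hq => rw [map_add, inner_add_right, hp, hq, add_def]; ring
  | hsmul r p hp => rw [map_smul, inner_smul_right, hp, smul_def]; ring
  | h0 => rw [rmul_one, one_def, one_mul]
  | h i =>
    obtain ⟨a, b, c, h⟩ := two_smul_e_eq_associator i
    have h2 : inner ℝ v (rmul w ((2 : ℝ) • e i.succ)) = 0 := by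
      rw [h, map_sub, inner_sub_right, hassoc, sub_self]
    rw [map_smul, inner_smul_right] at h2
    rw [e_succ_re, zero_mul]
    linarith

lemma inner_rmul_rmul_of_mem {v w : H} (hv : v ∈ octRe H) (hw : w ∈ octRe H) (p q : Octonion) :
    inner ℝ (rmul v p) (rmul w q) = (p.conj * q).c0 * inner ℝ v w := by
  rw [inner_rmul_left, rmul_rmul_of_mem hw, inner_rmul_of_mem hw hv, re_mul_comm]

/-- With `octRe_induction` this identifies `H` with `Re H ⊗ 𝕆` as an inner product space. -/
lemma oinner_rmul_rmul_of_mem {v w : H} (hv : v ∈ octRe H) (hw : w ∈ octRe H) (p q : Octonion) :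
    oinner (rmul v p) (rmul w q) = (inner ℝ v w : ℝ) • (p.conj * q) := by
  rw [oinner_eq_sum]
  conv_rhs => rw [← sum_mul_conj_e (p.conj * q), Finset.smul_sum]
  refine Finset.sum_congr rfl fun i _ => ?_
  rw [rmul_rmul_of_mem hw, inner_rmul_rmul_of_mem hv hw, ← re_mul_mul, smul_smul, mul_comm]

lemma inner_lmul_left (x y : H) (p : Octonion) :
    inner ℝ (lmul p x) y = inner ℝ x (lmul p.conj y) := by
  induction x using octRe_induction with
  | hadd x y hx hy => rw [map_add, inner_add_left, hx, hy, inner_add_left]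
  | h v hv a =>
    induction y using octRe_induction with
    | hadd x y hx hy => rw [map_add, inner_add_right, hx, hy, inner_add_right]
    | h w hw b =>
      rw [lmul_rmul_of_mem hv, lmul_rmul_of_mem hw, inner_rmul_rmul_of_mem hv hw,
        inner_rmul_rmul_of_mem hv hw, conj_mul, re_mul_mul]

lemma rmul_rmul_conj {M : Type*} [AddCommGroup M] [Module ℝ M] [OctBimodule M] (x : M)
    (p : Octonion) : rmul (rmul x p) p.conj = (p.abs ^ 2) • x := by
  rw [abs_sq]
  induction x using octRe_induction with
  | hadd x y hx hy => rw [map_add, LinearMap.add_apply, map_add, LinearMap.add_apply, hx, hy,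
      smul_add]
  | h v hv a => rw [rmul_rmul_of_mem hv, rmul_rmul_of_mem hv, mul_mul_conj_self, map_smul]

lemma lmul_conj_lmul {M : Type*} [AddCommGroup M] [Module ℝ M] [OctBimodule M] (x : M)
    (p : Octonion) : lmul p.conj (lmul p x) = (p.abs ^ 2) • x := by
  have h (a : Octonion) : p.conj * (p * a) = (p * p.conj).c0 • a := by
    ext <;> simp only [mul_def, conj, smul_def] <;> ring
  rw [abs_sq]
  induction x using octRe_induction with
  | hadd x y hx hy => rw [map_add, map_add, hx, hy, smul_add]
  | h v hv a => rw [lmul_rmul_of_mem hv, lmul_rmul_of_mem hv, h, map_smul]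

lemma norm_rmul (x : H) (p : Octonion) : ‖rmul x p‖ = p.abs * ‖x‖ := by
  rw [← sq_eq_sq₀ (norm_nonneg _) (mul_nonneg p.abs_nonneg (norm_nonneg _)),
    ← real_inner_self_eq_norm_sq, inner_rmul_left, rmul_rmul_conj, inner_smul_right,
    real_inner_self_eq_norm_sq, mul_pow]

lemma norm_lmul (x : H) (p : Octonion) : ‖lmul p x‖ = p.abs * ‖x‖ := by
  rw [← sq_eq_sq₀ (norm_nonneg _) (mul_nonneg p.abs_nonneg (norm_nonneg _)),
    ← real_inner_self_eq_norm_sq, inner_lmul_left, lmul_conj_lmul, inner_smul_right,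
    real_inner_self_eq_norm_sq, mul_pow]

/-- Right multiplication by an octonion as a bounded operator. -/
noncomputable def rmulL (p : Octonion) : H →L[ℝ] H :=
  (rmul.flip p : H →ₗ[ℝ] H).mkContinuous p.abs fun x => (norm_rmul x p).le

/-- Left multiplication by an octonion as a bounded operator. -/
noncomputable def lmulL (p : Octonion) : H →L[ℝ] H :=
  (lmul p : H →ₗ[ℝ] H).mkContinuous p.abs fun x => (norm_lmul x p).le

lemma rmulL_apply (p : Octonion) (x : H) : rmulL p x = rmul x p := rfl

lemma lmulL_apply (p : Octonion) (x : H) : lmulL p x = lmul p x := rfl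

lemma octRePart_eq (x : H) : octRePart x =
    ((5 / 12 : ℝ) • ContinuousLinearMap.id ℝ H - (1 / 12 : ℝ) • ∑ i : Fin 7,
      rmulL (e i.succ) ∘L lmulL (e i.succ) : H →L[ℝ] H) x := by
  simp [octRePart, rmulL_apply, lmulL_apply]

/-- The real part operator as a bounded operator. -/
noncomputable def octRePartL (H : Type*) [NormedAddCommGroup H] [InnerProductSpace ℝ H]
    [HilbertOctBimodule H] : H →L[ℝ] H :=
  ⟨octRePart, by
    change Continuous fun x : H => octRePart x
    simp only [octRePart_eq]
    exact ContinuousLinearMap.continuous _⟩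

lemma octRePartL_apply (x : H) : octRePartL H x = octRePart x := rfl

lemma isClosed_octRe : IsClosed (octRe H) := by
  have : octRe H = {x | octRePartL H x = x} := Set.ext fun _ => mem_octRe_iff
  rw [this]
  exact isClosed_eq (octRePartL H).continuous continuous_id

/-- The sum of `Re M` and `J Re M` (for a unit imaginary octonion `J`), as the space of elements
that commute with `J`. -/
def slice (M : Type*) [AddCommGroup M] [Module ℝ M] [OctBimodule M] (J : Octonion) :
    Submodule ℝ M :=
  LinearMap.ker (lmul J - rmul.flip J)

section Slice

variable {M : Type*} [AddCommGroup M] [Module ℝ M] [OctBimodule M] {J : Octonion}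

lemma mem_slice_iff {x : M} : x ∈ slice M J ↔ lmul J x = rmul x J := by
  rw [slice, LinearMap.mem_ker, LinearMap.sub_apply, sub_eq_zero]
  rfl

lemma octRe_subset_slice {v : M} (hv : v ∈ octRe M) : v ∈ slice M J :=
  mem_slice_iff.2 (lmul_of_mem hv J)

lemma rmul_mem_slice {v : M} (hv : v ∈ octRe M) : rmul v J ∈ slice M J :=
  mem_slice_iff.2 (by rw [lmul_rmul_of_mem hv, rmul_rmul_of_mem hv])

lemma exists_of_mem_slice (hJ : J.c0 = 0) (hJ1 : J.abs = 1) {x : M} (hx : x ∈ slice M J) :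
    ∃ u ∈ octRe M, ∃ v ∈ octRe M, x = u + rmul v J := by
  have h1 : (J * J.conj).c0 = 1 := by rw [← abs_sq, hJ1, one_pow]
  -- Decomposition of `a` along `1`, `J` and the complement of both, on which `J` anticommutes with
  -- `a`. The last summand vanishes when `a` commutes with `J`.
  have h2 (a : Octonion) : a = a.c0 • (1 : Octonion) - (J * a).c0 • J +
      (1 / 2 : ℝ) • (J * a * J - a * J * J) := by
    rw [mul_conj_re, hJ] at h1
    ext <;> simp only [mul_def, smul_def, sub_def, add_def, one_def, hJ]
    · ring
    · linear_combination -(a.c1) * h1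
    · linear_combination -(a.c2) * h1
    · linear_combination -(a.c3) * h1
    · linear_combination -(a.c4) * h1
    · linear_combination -(a.c5) * h1
    · linear_combination -(a.c6) * h1
    · linear_combination -(a.c7) * h1
  have h3 (x : M) : x = octRePart x - rmul (octRePart (lmul J x)) J +
      (1 / 2 : ℝ) • (rmul (lmul J x) J - rmul (rmul x J) J) := by
    induction x using octRe_induction with
    | hadd x y hx hy =>
      simp only [map_add, LinearMap.add_apply]
      linear_combination (norm := module) hx + hy
    | h v hv a =>
      rw [lmul_rmul_of_mem hv, octRePart_rmul_of_mem hv, octRePart_rmul_of_mem hv,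
        rmul_rmul_of_mem hv, rmul_rmul_of_mem hv, rmul_rmul_of_mem hv]
      conv_lhs => rw [h2 a]
      simp only [map_add, map_sub, map_smul, rmul_one, LinearMap.smul_apply]
  refine ⟨octRePart x, octRePart_mem x, -octRePart (lmul J x),
    (octReSubmodule M).neg_mem (octRePart_mem _), ?_⟩
  conv_lhs => rw [h3 x, mem_slice_iff.1 hx]
  rw [mem_slice_iff.1 hx]
  simp [sub_eq_add_neg]

lemma mem_sliceCone_iff {x : M} : x ∈ sliceCone M ↔
    ∃ J : Octonion, J.c0 = 0 ∧ J.abs = 1 ∧ x ∈ slice M J := by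
  refine exists_congr fun J => and_congr_right fun h0 => and_congr_right fun h1 =>
    ⟨?_, fun hx => ?_⟩
  · rintro ⟨u, hu, v, hv, rfl⟩
    rw [lmul_of_mem hv]
    exact (slice M J).add_mem (octRe_subset_slice hu) (rmul_mem_slice hv)
  · obtain ⟨u, hu, v, hv, rfl⟩ := exists_of_mem_slice h0 h1 hx
    exact ⟨u, hu, v, hv, by rw [lmul_of_mem hv]⟩

end Slice

lemma isClosed_slice (J : Octonion) : IsClosed (slice H J : Set H) := by
  have : (slice H J : Set H) = {x | lmulL J x = rmulL J x} := Set.ext fun _ => mem_slice_iff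
  rw [this]
  exact isClosed_eq (lmulL J).continuous (rmulL J).continuous

end HilbertBimodule

/-! ### Orthogonality within a slice and between slices. -/

section OrthonormalSystems

open Octonion OctBimodule HilbertOctBimodule

section Slice

variable {M : Type*} [AddCommGroup M] [Module ℝ M] [OctBimodule M] {J : Octonion}

lemma Octonion.imag_mul_self (hJ : J.c0 = 0) (hJ1 : J.abs = 1) : J * J = -1 := by
  have h1 : (J * J.conj).c0 = 1 := by rw [← abs_sq, hJ1, one_pow]
  rw [mul_conj_re, hJ] at h1
  rw [mul_self_of_imag hJ, neg_smul]
  congr 1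
  convert one_smul ℝ (1 : Octonion)
  linarith

lemma Octonion.imag_mul_mul (hJ : J.c0 = 0) (hJ1 : J.abs = 1) (a : Octonion) :
    J * (J * a) = -a := by
  have h : J * (J * a) = J * J * a := by
    ext <;> simp only [mul_def] <;> ring
  rw [h, imag_mul_self hJ hJ1, neg_mul, one_mul]

/-- For components `u`, `v J` the claim is an identity in the subalgebra generated by `J` and `p`,
which is associative. -/
lemma rmul_imag_rmul (hJ : J.c0 = 0) (hJ1 : J.abs = 1) {x : M} (hx : x ∈ slice M J)
    (p : Octonion) : rmul (rmul x J) p = rmul x (J * p) := by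
  obtain ⟨u, hu, v, hv, rfl⟩ := exists_of_mem_slice hJ hJ1 hx
  simp only [map_add, LinearMap.add_apply, rmul_rmul_of_mem hu, rmul_rmul_of_mem hv,
    imag_mul_self hJ hJ1, imag_mul_mul hJ hJ1, neg_mul, one_mul]

lemma rmul_imag_mem_slice (hJ : J.c0 = 0) (hJ1 : J.abs = 1) {x : M} (hx : x ∈ slice M J) :
    rmul x J ∈ slice M J := by
  obtain ⟨u, hu, v, hv, rfl⟩ := exists_of_mem_slice hJ hJ1 hx
  rw [map_add, LinearMap.add_apply, rmul_rmul_of_mem hv, imag_mul_self hJ hJ1, map_neg, rmul_one]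
  exact (slice M J).add_mem (rmul_mem_slice hu) ((slice M J).neg_mem (octRe_subset_slice hv))

end Slice

variable {H : Type*} [NormedAddCommGroup H] [InnerProductSpace ℝ H] [HilbertOctBimodule H]
  {J K : Octonion}

lemma oinner_slice_rmul (hJ : J.c0 = 0) {u v w : H} (hu : u ∈ octRe H) (hv : v ∈ octRe H)
    (hw : w ∈ octRe H) (q : Octonion) : oinner (u + rmul v J) (rmul w q) =
      (inner ℝ u w : ℝ) • q - (inner ℝ v w : ℝ) • (J * q) := by
  have := oinner_rmul_rmul_of_mem hu hw 1 q
  rw [rmul_one, conj_one, one_mul] at this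
  rw [map_add, LinearMap.add_apply, this, oinner_rmul_rmul_of_mem hv hw, conj_of_imag hJ,
    neg_mul, smul_neg, sub_eq_add_neg]

lemma oinner_rmul_of_mem_slice (hJ : J.c0 = 0) (hJ1 : J.abs = 1) {z w : H} (hz : z ∈ slice H J)
    (hw : w ∈ slice H J) (p : Octonion) : oinner z (rmul w p) = oinner z w * p := by
  obtain ⟨u, hu, v, hv, rfl⟩ := exists_of_mem_slice hJ hJ1 hz
  obtain ⟨u', hu', v', hv', rfl⟩ := exists_of_mem_slice hJ hJ1 hw
  have h4 := oinner_slice_rmul hJ hu hv hu' 1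
  rw [rmul_one, mul_one] at h4
  rw [map_add rmul u', LinearMap.add_apply, map_add (oinner _), map_add (oinner _),
    rmul_rmul_of_mem hv', oinner_slice_rmul hJ hu hv hu', oinner_slice_rmul hJ hu hv hv',
    oinner_slice_rmul hJ hu hv hv', h4, imag_mul_mul hJ hJ1, imag_mul_self hJ hJ1]
  simp only [add_mul, sub_mul, smul_mul_assoc, one_mul, neg_mul, smul_neg]

lemma inner_slice (hJ : J.c0 = 0) (hK : K.c0 = 0) {u v u' v' : H} (hu : u ∈ octRe H)
    (hv : v ∈ octRe H) (hu' : u' ∈ octRe H) (hv' : v' ∈ octRe H) :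
    inner ℝ (u + rmul v J) (u' + rmul v' K) = inner ℝ u u' - (J * K).c0 * inner ℝ v v' := by
  have h1 := inner_rmul_of_mem hv' hu K
  have h2 := inner_rmul_of_mem hv hu' J
  rw [real_inner_comm] at h2
  rw [inner_add_left, inner_add_right, inner_add_right, h1, h2, inner_rmul_rmul_of_mem hv hv',
    conj_of_imag hJ, hJ, hK, neg_mul, neg_def]
  ring

/-- On one slice the octonionic inner product takes values in `ℝ + ℝ J`, so the slice is a complex
Hermitian space with `J` acting on the right. -/
lemma oinner_of_mem_slice (hJ : J.c0 = 0) (hJ1 : J.abs = 1) {z w : H} (hz : z ∈ slice H J)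
    (hw : w ∈ slice H J) :
    oinner z w = (inner ℝ z w : ℝ) • (1 : Octonion) + (inner ℝ (rmul z J) w : ℝ) • J := by
  obtain ⟨u, hu, v, hv, rfl⟩ := exists_of_mem_slice hJ hJ1 hz
  obtain ⟨u', hu', v', hv', rfl⟩ := exists_of_mem_slice hJ hJ1 hw
  have h3 : rmul (u + rmul v J) J = -v + rmul u J := by
    rw [map_add, LinearMap.add_apply, rmul_rmul_of_mem hv, imag_mul_self hJ hJ1, map_neg, rmul_one,
      add_comm]
  rw [h3, inner_slice hJ hJ hu hv hu' hv',
    inner_slice hJ hJ ((octReSubmodule H).neg_mem hv) hu hu' hv', imag_mul_self hJ hJ1]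
  have h4 := oinner_slice_rmul hJ hu hv hu' 1
  rw [rmul_one, mul_one] at h4
  rw [map_add, h4, oinner_slice_rmul hJ hu hv hv', imag_mul_self hJ hJ1, inner_neg_left,
    show (-1 : Octonion).c0 = -1 from rfl]
  module

/-- Two elements of slices that are orthogonal over the complex numbers of these slices lie in the
same slice or have orthogonal components. -/
lemma mem_slice_or_inner_eq_zero (hJ : J.c0 = 0) (hJ1 : J.abs = 1) (hK : K.c0 = 0)
    (hK1 : K.abs = 1) {u v u' v' : H} (hu : u ∈ octRe H) (hv : v ∈ octRe H) (hu' : u' ∈ octRe H)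
    (hv' : v' ∈ octRe H) (h1 : inner ℝ (u + rmul v J) (u' + rmul v' K) = 0)
    (h2 : inner ℝ (rmul (u + rmul v J) J) (u' + rmul v' K) = 0)
    (h3 : inner ℝ (u + rmul v J) (rmul (u' + rmul v' K) K) = 0)
    (h4 : inner ℝ (rmul (u + rmul v J) J) (rmul (u' + rmul v' K) K) = 0) :
    u' + rmul v' K ∈ slice H J ∨
      (inner ℝ u u' = 0 ∧ inner ℝ u v' = 0 ∧ inner ℝ v u' = 0 ∧ inner ℝ v v' = 0) := by
  have g (L : Octonion) (hL : L.c0 = 0) (hL1 : L.abs = 1) (a b : H) (hb : b ∈ octRe H) :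
      rmul (a + rmul b L) L = -b + rmul a L := by
    rw [map_add, LinearMap.add_apply, rmul_rmul_of_mem hb, imag_mul_self hL hL1, map_neg, rmul_one,
      add_comm]
  have nv := (octReSubmodule H).neg_mem hv
  have nv' := (octReSubmodule H).neg_mem hv'
  rw [g J hJ hJ1 u v hv] at h2 h4
  rw [g K hK hK1 u' v' hv'] at h3 h4
  rw [inner_slice hJ hK hu hv hu' hv'] at h1
  rw [inner_slice hJ hK nv hu hu' hv', inner_neg_left] at h2
  rw [inner_slice hJ hK hu hv nv' hu', inner_neg_right] at h3
  rw [inner_slice hJ hK nv hu nv' hu', inner_neg_left, inner_neg_right] at h4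
  have nJ : (J * J.conj).c0 = 1 := by rw [← abs_sq, hJ1, one_pow]
  have nK : (K * K.conj).c0 = 1 := by rw [← abs_sq, hK1, one_pow]
  rw [mul_conj_re, hJ] at nJ
  rw [mul_conj_re, hK] at nK
  have ht : (J * K).c0 = -(J.c1 * K.c1 + J.c2 * K.c2 + J.c3 * K.c3 + J.c4 * K.c4 + J.c5 * K.c5 +
      J.c6 * K.c6 + J.c7 * K.c7) := by
    simp only [mul_def, hJ, hK]; ring
  generalize (J * K).c0 = t at *
  -- Here `t = -⟨J, K⟩` and `|K + t J|² = 1 - t²`, so `t² = 1` means `K = ∓J`, a common slice.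
  -- Otherwise the hypotheses are two 2×2 linear systems in the four inner products, of determinant
  -- `±(1 - t²)`.
  by_cases ht1 : t ^ 2 = 1
  · left
    have hs : (K.c1 + t * J.c1) ^ 2 + (K.c2 + t * J.c2) ^ 2 + (K.c3 + t * J.c3) ^ 2 +
        (K.c4 + t * J.c4) ^ 2 + (K.c5 + t * J.c5) ^ 2 + (K.c6 + t * J.c6) ^ 2 +
        (K.c7 + t * J.c7) ^ 2 = 0 := by
      linear_combination nK + t ^ 2 * nJ + 2 * t * ht - ht1
    have p1 := sq_nonneg (K.c1 + t * J.c1)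
    have p2 := sq_nonneg (K.c2 + t * J.c2)
    have p3 := sq_nonneg (K.c3 + t * J.c3)
    have p4 := sq_nonneg (K.c4 + t * J.c4)
    have p5 := sq_nonneg (K.c5 + t * J.c5)
    have p6 := sq_nonneg (K.c6 + t * J.c6)
    have p7 := sq_nonneg (K.c7 + t * J.c7)
    have z (r : ℝ) (h : 0 ≤ r) (h' : r ≤ 0) : r = 0 := le_antisymm h' h
    have hK2 : K = (-t) • J := by
      ext <;> simp only [smul_def, hJ, hK]
      · ring
      · linear_combination pow_eq_zero_iff two_ne_zero |>.1 (z _ p1 (by linarith only [hs, p2, p3, p4, p5, p6, p7]))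
      · linear_combination pow_eq_zero_iff two_ne_zero |>.1 (z _ p2 (by linarith only [hs, p1, p3, p4, p5, p6, p7]))
      · linear_combination pow_eq_zero_iff two_ne_zero |>.1 (z _ p3 (by linarith only [hs, p1, p2, p4, p5, p6, p7]))
      · linear_combination pow_eq_zero_iff two_ne_zero |>.1 (z _ p4 (by linarith only [hs, p1, p2, p3, p5, p6, p7]))
      · linear_combination pow_eq_zero_iff two_ne_zero |>.1 (z _ p5 (by linarith only [hs, p1, p2, p3, p4, p6, p7]))
      · linear_combination pow_eq_zero_iff two_ne_zero |>.1 (z _ p6 (by linarith only [hs, p1, p2, p3, p4, p5, p7]))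
      · linear_combination pow_eq_zero_iff two_ne_zero |>.1 (z _ p7 (by linarith only [hs, p1, p2, p3, p4, p5, p6]))
    rw [hK2, map_smul]
    exact (slice H J).add_mem (octRe_subset_slice hu') ((slice H J).smul_mem _ (rmul_mem_slice hv'))
  · right
    have ht2 : 1 - t ^ 2 ≠ 0 := sub_ne_zero.2 (Ne.symm ht1)
    refine ⟨?_, ?_, ?_, ?_⟩ <;> apply (mul_eq_zero_iff_left ht2).1
    · linear_combination h1 + t * h4
    · linear_combination -h3 + t * h2
    · linear_combination -h2 + t * h3
    · linear_combination h4 + t * h1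

end OrthonormalSystems

/-! ### Maximal orthonormal systems in the slice cone are complete. -/

section Completeness

open Octonion OctBimodule HilbertOctBimodule

variable {H : Type*} [NormedAddCommGroup H] [InnerProductSpace ℝ H] [HilbertOctBimodule H]
  {J K : Octonion}

lemma oinner_eq_zero_of_components {u v y : H} (hu : u ∈ octRe H) (hv : v ∈ octRe H)
    (hJ : J.c0 = 0) (hy : y ∈ octRe H) (h1 : inner ℝ u y = 0) (h2 : inner ℝ v y = 0)
    (q : Octonion) : oinner (u + rmul v J) (rmul y q) = 0 := by
  rw [oinner_slice_rmul hJ hu hv hy, h1, h2, zero_smul, zero_smul, sub_zero]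

/-- Orthogonal elements of two slices either lie in one slice, or the components of the first are
orthogonal to the second (and conversely). -/
lemma mem_slice_or_of_oinner_eq_zero (hJ : J.c0 = 0) (hJ1 : J.abs = 1) (hK : K.c0 = 0)
    (hK1 : K.abs = 1) {u v u' v' : H} (hu : u ∈ octRe H) (hv : v ∈ octRe H) (hu' : u' ∈ octRe H)
    (hv' : v' ∈ octRe H) (h : oinner (u + rmul v J) (u' + rmul v' K) = 0) :
    u' + rmul v' K ∈ slice H J ∨
      (inner ℝ u u' = 0 ∧ inner ℝ u v' = 0 ∧ inner ℝ v u' = 0 ∧ inner ℝ v v' = 0) := by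
  rw [oinner_eq_zero_iff] at h
  have hw : u' + rmul v' K ∈ slice H K :=
    (slice H K).add_mem (octRe_subset_slice hu') (rmul_mem_slice hv')
  refine mem_slice_or_inner_eq_zero hJ hJ1 hK hK1 hu hv hu' hv' ?_ ?_ (h _) ?_
  · simpa only [rmul_one] using h 1
  · rw [inner_rmul_left, h]
  · rw [inner_rmul_left, rmul_imag_rmul hK hK1 hw, h]

/-- Fails for general vectors, as the inner product is only para-linear; in the cone both cases of
the slice dichotomy give it. -/
lemma oinner_rmul_eq_zero_of_mem_sliceCone {z w : H} (hz : z ∈ sliceCone H) (hw : w ∈ sliceCone H)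
    (h : oinner z w = 0) (p : Octonion) : oinner z (rmul w p) = 0 := by
  obtain ⟨J, hJ, hJ1, hz⟩ := mem_sliceCone_iff.1 hz
  obtain ⟨K, hK, hK1, hw⟩ := mem_sliceCone_iff.1 hw
  obtain ⟨u, hu, v, hv, rfl⟩ := exists_of_mem_slice hJ hJ1 hz
  obtain ⟨u', hu', v', hv', rfl⟩ := exists_of_mem_slice hK hK1 hw
  obtain h2 | ⟨h1, h2, h3, h4⟩ := mem_slice_or_of_oinner_eq_zero hJ hJ1 hK hK1 hu hv hu' hv' h
  · rw [oinner_rmul_of_mem_slice hJ hJ1 hz h2, h, zero_mul]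
  · rw [map_add rmul, LinearMap.add_apply, map_add, rmul_rmul_of_mem hv',
      oinner_eq_zero_of_components hu hv hJ hu' h1 h3,
      oinner_eq_zero_of_components hu hv hJ hv' h2 h4, add_zero]

/-- Orthonormal systems in the slice cone are weak associative. -/
lemma IsOctOrthonormal.isWeakAssocOrthonormal {S : Set H} (hS : IsOctOrthonormal S)
    (hcone : S ⊆ sliceCone H) : IsWeakAssocOrthonormal S := by
  refine ⟨hS, fun z hz w hw p => ?_⟩
  by_cases hzw : z = w
  · subst hzw
    obtain ⟨J, hJ, hJ1, hz'⟩ := mem_sliceCone_iff.1 (hcone hz)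
    rw [oinner_rmul_of_mem_slice hJ hJ1 hz' hz', sub_self]
  · have h := hS.2 z hz w hw hzw
    rw [h, oinner_rmul_eq_zero_of_mem_sliceCone (hcone hz) (hcone hw) h, zero_mul, sub_zero]

lemma IsWeakAssocOrthonormal.oinner_rmul {S : Set H} (hS : IsWeakAssocOrthonormal S) {z w : H}
    (hz : z ∈ S) (hw : w ∈ S) (p : Octonion) : oinner z (rmul w p) = oinner z w * p :=
  (sub_eq_zero.1 (hS.2 z hz w hw p)).symm

lemma IsWeakAssocOrthonormal.oinner_rmul_self {S : Set H} (hS : IsWeakAssocOrthonormal S) {z : H}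
    (hz : z ∈ S) (p : Octonion) : oinner z (rmul z p) = p := by
  rw [hS.oinner_rmul hz hz, hS.1.1 z hz, one_mul]

lemma IsWeakAssocOrthonormal.oinner_rmul_of_ne {S : Set H} (hS : IsWeakAssocOrthonormal S)
    {z w : H} (hz : z ∈ S) (hw : w ∈ S) (hzw : z ≠ w) (p : Octonion) : oinner z (rmul w p) = 0 := by
  rw [hS.oinner_rmul hz hw, hS.1.2 z hz w hw hzw, zero_mul]

/-- The closed real span of the octonion multiples of a set. -/
def octSpan (S : Set H) : Submodule ℝ H :=
  (Submodule.span ℝ {y : H | ∃ z ∈ S, ∃ p : Octonion, y = rmul z p}).topologicalClosure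

lemma rmul_mem_octSpan {S : Set H} {z : H} (hz : z ∈ S) (p : Octonion) : rmul z p ∈ octSpan S :=
  Submodule.le_topologicalClosure _ (Submodule.subset_span ⟨z, hz, p, rfl⟩)

lemma isClosed_octSpan (S : Set H) : IsClosed (octSpan S : Set H) :=
  Submodule.isClosed_topologicalClosure _

lemma topologicalClosure_span_le {E : Type*} [NormedAddCommGroup E] [NormedSpace ℝ E] {S : Set E}
    {N : Submodule ℝ E} (hN : IsClosed (N : Set E)) (h : S ⊆ N) : (Submodule.span ℝ S).topologicalClosure ≤ N :=
  Submodule.topologicalClosure_minimal _ (Submodule.span_le.2 h) hN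

lemma isClosed_ker_oinner (z : H) : IsClosed (LinearMap.ker (oinner z) : Set H) := by
  have : (LinearMap.ker (oinner z) : Set H) =
      ⋂ p, {x | inner ℝ z (rmulL p x) = 0} := by
    ext x
    simp only [SetLike.mem_coe, LinearMap.mem_ker, oinner_eq_zero_iff, Set.mem_iInter,
      Set.mem_ofPred_eq, rmulL_apply]
  rw [this]
  exact isClosed_iInter fun p => isClosed_eq (by fun_prop) continuous_const

lemma isClosed_comap_rmulL {N : Submodule ℝ H} (hN : IsClosed (N : Set H)) (p : Octonion) :
    IsClosed (N.comap (rmulL p : H →L[ℝ] H).toLinearMap : Set H) :=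
  hN.preimage (rmulL p).continuous

/-- A weak associative orthonormal system that spans a dense subspace is maximal. -/
lemma IsWeakAssocOrthonormal.maximal_of_octSpan_eq_top {B : Set H}
    (hB : IsWeakAssocOrthonormal B) (htop : octSpan B = ⊤) : Maximal IsWeakAssocOrthonormal B := by
  refine ⟨hB, fun B' hB' hle x hx => ?_⟩
  by_contra hxB
  have h : octSpan B ≤ LinearMap.ker (oinner x) := by
    refine topologicalClosure_span_le (isClosed_ker_oinner x) ?_
    rintro _ ⟨z, hz, p, rfl⟩
    exact hB'.oinner_rmul_of_ne hx (hle hz) (fun h => hxB (h ▸ hz)) p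
  have h2 : oinner x x = 0 := h (htop ▸ Submodule.mem_top)
  rw [hB'.1.1 x hx] at h2
  exact one_ne_zero (congrArg Octonion.c0 h2)

lemma smul_mem_sliceCone {x : H} (hx : x ∈ sliceCone H) (r : ℝ) : r • x ∈ sliceCone H := by
  obtain ⟨J, hJ, hJ1, hx⟩ := mem_sliceCone_iff.1 hx
  exact mem_sliceCone_iff.2 ⟨J, hJ, hJ1, (slice H J).smul_mem r hx⟩

lemma octRe_subset_sliceCone : octRe H ⊆ sliceCone H := fun _ hv =>
  mem_sliceCone_iff.2 ⟨e 1, rfl, abs_e 1, octRe_subset_slice hv⟩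

/-- Otherwise the normalized vector could be adjoined: an orthonormal system in the cone is
automatically weak associative. -/
lemma eq_zero_of_maximal {B : Set H} (hB : Maximal IsWeakAssocOrthonormal B)
    (hcone : B ⊆ sliceCone H) {x : H} (hx : x ∈ sliceCone H) (h : ∀ w ∈ B, oinner w x = 0) :
    x = 0 := by
  by_contra hx0
  have hn : ‖x‖ ≠ 0 := norm_ne_zero_iff.2 hx0
  set y := ‖x‖⁻¹ • x with hy
  have hyy : oinner y y = 1 := by
    rw [oinner_self, hy, norm_smul, norm_inv, norm_norm, inv_mul_cancel₀ hn, one_pow, one_smul]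
  have hwy (w : H) (hw : w ∈ B) : oinner w y = 0 := by rw [hy, map_smul, h w hw, smul_zero]
  have hins : IsWeakAssocOrthonormal (insert y B) := by
    refine IsOctOrthonormal.isWeakAssocOrthonormal ⟨?_, ?_⟩ ?_
    · rintro z (rfl | hz)
      exacts [hyy, hB.1.1.1 z hz]
    · rintro z (rfl | hz) w (rfl | hw) hzw
      · exact absurd rfl hzw
      · exact oinner_eq_zero_comm.1 (hwy w hw)
      · exact hwy z hz
      · exact hB.1.1.2 z hz w hw hzw
    · rintro z (rfl | hz)
      exacts [smul_mem_sliceCone hx _, hcone hz]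
  have hyB : y ∈ B := hB.2 hins (Set.subset_insert y B) (Set.mem_insert y B)
  have := hwy y hyB
  rw [hyy] at this
  exact one_ne_zero (congrArg Octonion.c0 this)

/-- For a member `u + v J` of an orthonormal system in the slice cone, every other member lies in
the slice of `J` or is orthogonal to `u` and `v`. -/
lemma IsWeakAssocOrthonormal.mem_slice_or {B : Set H} (hB : IsWeakAssocOrthonormal B)
    (hcone : B ⊆ sliceCone H) (hJ : J.c0 = 0) (hJ1 : J.abs = 1) {u v : H} (hu : u ∈ octRe H)
    (hv : v ∈ octRe H) (huv : u + rmul v J ∈ B) {w : H} (hw : w ∈ B) :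
    w ∈ slice H J ∨ oinner w u = 0 ∧ oinner w v = 0 := by
  by_cases h : u + rmul v J = w
  · rw [← h]
    exact Or.inl ((slice H J).add_mem (octRe_subset_slice hu) (rmul_mem_slice hv))
  obtain ⟨K, hK, hK1, hw'⟩ := mem_sliceCone_iff.1 (hcone hw)
  obtain ⟨u', hu', v', hv', rfl⟩ := exists_of_mem_slice hK hK1 hw'
  refine (mem_slice_or_of_oinner_eq_zero hJ hJ1 hK hK1 hu hv hu' hv'
    (hB.1.2 _ huv _ hw h)).imp_right fun ⟨h1, h2, h3, h4⟩ => ⟨?_, ?_⟩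
  · rw [← rmul_one u]
    exact oinner_eq_zero_of_components hu' hv' hK hu (real_inner_comm u' u ▸ h1)
      (real_inner_comm v' u ▸ h2) 1
  · rw [← rmul_one v]
    exact oinner_eq_zero_of_components hu' hv' hK hv (real_inner_comm u' v ▸ h3)
      (real_inner_comm v' v ▸ h4) 1

variable [CompleteSpace H]

/-- The complex span `N` of the members of `B` in the slice of `J` is contained in that slice. The
remainder of `y` after projection to `N` stays in the slice and is orthogonal to all of `B`: inside
the slice by projection, outside it by `h`. Maximality makes it zero. -/
lemma rmul_mem_octSpan_of_maximal {B : Set H} (hB : Maximal IsWeakAssocOrthonormal B)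
    (hcone : B ⊆ sliceCone H) (hJ : J.c0 = 0) (hJ1 : J.abs = 1) {y : H} (hy : y ∈ octRe H)
    (h : ∀ w ∈ B, w ∈ slice H J ∨ oinner w y = 0) (p : Octonion) : rmul y p ∈ octSpan B := by
  set G : Set H := {x | ∃ z ∈ B, z ∈ slice H J ∧ (x = z ∨ x = rmul z J)} with hG
  set N : Submodule ℝ H := (Submodule.span ℝ G).topologicalClosure with hN
  have hNclosed : IsClosed (N : Set H) := Submodule.isClosed_topologicalClosure _
  have hGN {x : H} (hx : x ∈ G) : x ∈ N :=
    Submodule.le_topologicalClosure _ (Submodule.subset_span hx)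
  have : CompleteSpace N := hNclosed.completeSpace_coe
  have hNs : N ≤ slice H J := by
    refine topologicalClosure_span_le (isClosed_slice J) ?_
    rintro _ ⟨z, hz, hzJ, rfl | rfl⟩
    exacts [hzJ, rmul_imag_mem_slice hJ hJ1 hzJ]
  have hNspan : N ≤ (octSpan B).comap (rmulL p : H →L[ℝ] H).toLinearMap := by
    refine topologicalClosure_span_le (isClosed_comap_rmulL (isClosed_octSpan B) p) ?_
    rintro _ ⟨z, hz, hzJ, rfl | rfl⟩
    · exact rmul_mem_octSpan hz p
    · change rmul (rmul z J) p ∈ octSpan B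
      rw [rmul_imag_rmul hJ hJ1 hzJ]
      exact rmul_mem_octSpan hz _
  set n : H := N.starProjection y with hn
  have hnN : n ∈ N := N.starProjection_apply_mem y
  have horth : y - n ∈ Nᗮ := N.sub_starProjection_mem_orthogonal y
  have hxs : y - n ∈ slice H J := (slice H J).sub_mem (octRe_subset_slice hy) (hNs hnN)
  have hx0 : y - n = 0 := by
    refine eq_zero_of_maximal hB hcone (mem_sliceCone_iff.2 ⟨J, hJ, hJ1, hxs⟩) fun w hw => ?_
    by_cases hwJ : w ∈ slice H J
    · rw [oinner_of_mem_slice hJ hJ1 hwJ hxs, horth w (hGN ⟨w, hw, hwJ, Or.inl rfl⟩),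
        horth (rmul w J) (hGN ⟨w, hw, hwJ, Or.inr rfl⟩), zero_smul, zero_smul, add_zero]
    · have hNw : N ≤ LinearMap.ker (oinner w) := by
        refine topologicalClosure_span_le (isClosed_ker_oinner w) ?_
        rintro _ ⟨z, hz, hzJ, rfl | rfl⟩
        · exact hB.1.1.2 w hw _ hz fun h => hwJ (h ▸ hzJ)
        · exact hB.1.oinner_rmul_of_ne hw hz (fun h => hwJ (h ▸ hzJ)) J
      have h1 : oinner w n = 0 := hNw hnN
      rw [map_sub, h1, (h w hw).resolve_left hwJ, sub_zero]
  rw [sub_eq_zero.1 hx0]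
  exact hNspan hnN

/-- Maximal weak associative orthonormal systems in the slice cone are complete. -/
theorem octSpan_eq_top_of_maximal {B : Set H} (hB : Maximal IsWeakAssocOrthonormal B)
    (hcone : B ⊆ sliceCone H) : octSpan B = ⊤ := by
  -- Real vectors all of whose octonion multiples are in the span. Projecting to `U`, not to the
  -- span, keeps the remainder real and hence in the slice cone, where maximality applies.
  set U : Submodule ℝ H := octReSubmodule H ⊓
    ⨅ p, (octSpan B).comap (rmulL p : H →L[ℝ] H).toLinearMap with hU
  have hmem {y : H} : y ∈ U ↔ y ∈ octRe H ∧ ∀ p, rmul y p ∈ octSpan B := by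
    simp [hU, Submodule.mem_iInf, rmulL_apply]
  have hUclosed : IsClosed (U : Set H) := by
    rw [hU, Submodule.coe_inf, Submodule.coe_iInf]
    exact isClosed_octRe.inter (isClosed_iInter fun p =>
      isClosed_comap_rmulL (isClosed_octSpan B) p)
  have : CompleteSpace U := hUclosed.completeSpace_coe
  have hre {y : H} (hy : y ∈ octRe H) : y ∈ U := by
    set n : H := U.starProjection y with hn
    have hnU : n ∈ U := U.starProjection_apply_mem y
    have horth : y - n ∈ Uᗮ := U.sub_starProjection_mem_orthogonal y
    have hx : y - n ∈ octRe H := (octReSubmodule H).sub_mem hy (hmem.1 hnU).1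
    have hx0 : y - n = 0 := by
      refine eq_zero_of_maximal hB hcone (octRe_subset_sliceCone hx) fun w hw => ?_
      obtain ⟨J, hJ, hJ1, hw'⟩ := mem_sliceCone_iff.1 (hcone hw)
      obtain ⟨u, hu, v, hv, rfl⟩ := exists_of_mem_slice hJ hJ1 hw'
      -- Both components of every basis vector lie in `U`, so a real remainder orthogonal to `U` is
      -- octonionically orthogonal to the basis.
      have huU : u ∈ U := hmem.2 ⟨hu, rmul_mem_octSpan_of_maximal hB hcone hJ hJ1 hu fun w' hw'' =>
        (hB.1.mem_slice_or hcone hJ hJ1 hu hv hw hw'').imp_right And.left⟩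
      have hvU : v ∈ U := hmem.2 ⟨hv, rmul_mem_octSpan_of_maximal hB hcone hJ hJ1 hv fun w' hw'' =>
        (hB.1.mem_slice_or hcone hJ hJ1 hu hv hw hw'').imp_right And.right⟩
      rw [← rmul_one (y - n)]
      exact oinner_eq_zero_of_components hu hv hJ hx (horth u huU) (horth v hvU) 1
    rw [sub_eq_zero.1 hx0]
    exact hnU
  refine Submodule.eq_top_iff'.2 fun x => ?_
  induction x using octRe_induction with
  | hadd x y hx hy => exact (octSpan B).add_mem hx hy
  | h v hv p => exact (hmem.1 (hre hv)).2 p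

end Completeness

/-! ### Existence of an eigenbasis. -/

section Existence

open Octonion OctBimodule HilbertOctBimodule

lemma IsParaLinear.map_rmul_imag {M : Type*} [AddCommGroup M] [Module ℝ M] [OctBimodule M]
    {f : M →ₗ[ℝ] M} (hf : IsParaLinear f) {J : Octonion} (hJ : J.c0 = 0) (hJ1 : J.abs = 1) {x : M}
    (hx : x ∈ slice M J) : f (rmul x J) = rmul (f x) J := by
  obtain ⟨u, hu, v, hv, rfl⟩ := exists_of_mem_slice hJ hJ1 hx
  have h (y : M) : rmul (rmul y J) J = -y := by
    have := rmul_rmul_conj y J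
    rwa [conj_of_imag hJ, hJ1, one_pow, one_smul, map_neg, neg_eq_iff_eq_neg] at this
  simp only [map_add, LinearMap.add_apply, hf.map_rmul hu, hf.map_rmul hv, h, map_neg]

variable {H : Type*} [NormedAddCommGroup H] [InnerProductSpace ℝ H] [HilbertOctBimodule H]

lemma isOctAdjoint_iff {T S : H →L[ℝ] H} :
    IsOctAdjoint T S ↔ ∀ x y, inner ℝ (S y) x = inner ℝ y (T x) := by
  have hre (q : Octonion) : q.re = q.c0 := rfl
  refine ⟨fun h x y => ?_, fun h x y => ?_⟩
  · have h2 := congrArg Octonion.c0 (h x y)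
    have h0 : (e 0).conj = 1 := conj_one
    rw [oinner_re, Fin.sum_univ_eight, h0, rmul_one] at h2
    simpa [add_def, smul_def, e_zero, one_def, e_one_def, e_two_def, e_three_def, e_four_def,
      e_five_def, e_six_def, e_seven_def, hre, oinner_re] using h2
  · rw [oinner_eq_sum]
    simp only [hre, oinner_re, h]

lemma IsOctAdjoint.isSymmetric {T : H →L[ℝ] H} (h : IsOctAdjoint T T) :
    (T : H →ₗ[ℝ] H).IsSymmetric := fun x y => isOctAdjoint_iff.1 h y x

/-- Para-linearity makes `z J` and `w K` eigenvectors too, for the slices containing `z` and `w`.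
Symmetry gives the four real orthogonality relations needed for the slice dichotomy. -/
lemma oinner_eq_zero_of_eigenvectors {T : H →L[ℝ] H} (hT : IsParaLinear (T : H →ₗ[ℝ] H))
    (hTs : (T : H →ₗ[ℝ] H).IsSymmetric) {z w : H} (hz : z ∈ sliceCone H) (hw : w ∈ sliceCone H)
    {μ ν : ℝ} (hμν : μ ≠ ν) (hTz : T z = μ • z) (hTw : T w = ν • w) : oinner z w = 0 := by
  have horth {x y : H} (hx : T x = μ • x) (hy : T y = ν • y) : inner ℝ x y = 0 := by
    have h : inner ℝ (T x) y = inner ℝ x (T y) := hTs x y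
    rw [hx, hy, inner_smul_left, inner_smul_right] at h
    exact (mul_eq_zero.1 (show (μ - ν) * inner ℝ x y = 0 by
      rw [sub_mul]; exact sub_eq_zero.2 h)).resolve_left (sub_ne_zero.2 hμν)
  have hmul {x : H} {r : ℝ} {L : Octonion} (hL : L.c0 = 0) (hL1 : L.abs = 1) (hx : x ∈ slice H L)
      (h : T x = r • x) : T (rmul x L) = r • rmul x L := by
    have := hT.map_rmul_imag hL hL1 hx
    rw [ContinuousLinearMap.coe_coe] at this
    rw [this, h, map_smul, LinearMap.smul_apply]
  obtain ⟨J, hJ, hJ1, hz'⟩ := mem_sliceCone_iff.1 hz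
  obtain ⟨K, hK, hK1, hw'⟩ := mem_sliceCone_iff.1 hw
  have hzJ := hmul hJ hJ1 hz' hTz
  have hwK := hmul hK hK1 hw' hTw
  by_cases hwJ : w ∈ slice H J
  · rw [oinner_of_mem_slice hJ hJ1 hz' hwJ, horth hTz hTw, horth hzJ hTw, zero_smul, zero_smul,
      add_zero]
  · obtain ⟨u, hu, v, hv, rfl⟩ := exists_of_mem_slice hJ hJ1 hz'
    obtain ⟨u', hu', v', hv', rfl⟩ := exists_of_mem_slice hK hK1 hw'
    obtain ⟨h1, h2, h3, h4⟩ := (mem_slice_or_inner_eq_zero hJ hJ1 hK hK1 hu hv hu' hv'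
      (horth hTz hTw) (horth hzJ hTw) (horth hTz hwK) (horth hzJ hwK)).resolve_left hwJ
    have h5 := oinner_eq_zero_of_components hu hv hJ hu' h1 h3 1
    rw [rmul_one] at h5
    rw [map_add, h5, oinner_eq_zero_of_components hu hv hJ hv' h2 h4, add_zero]

theorem exists_isEigenbasis [CompleteSpace H] (T : H →L[ℝ] H)
    (hT_para : IsParaLinear (T : H →ₗ[ℝ] H)) (hT_compact : IsCompactOperator T)
    (hT_self : IsOctAdjoint T T)
    (hT_eig : ∀ μ : ℝ, (∃ x : H, x ≠ 0 ∧ T x = μ • x) →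
      IsStandardStrongEigenvalue T (μ • (1 : Octonion))) :
    ∃ (B : Set H) (lam : B → ℝ), IsEigenbasis T B lam := by
  have hTs := hT_self.isSymmetric
  have hex (μ : ℝ) : ∃ S : Set H, S ⊆ sliceCone H ∧ IsOctOrthonormal S ∧
      (∀ z ∈ S, T z = μ • z) ∧ ∀ x : H, T x = μ • x → x ∈ octSpan S := by
    by_cases h : ∃ x : H, x ≠ 0 ∧ T x = μ • x
    · obtain ⟨S, h1, h2, h3, h4⟩ := hT_eig μ h
      simp only [map_smul, rmul_one] at h3 h4
      exact ⟨S, h1, h2, h3, h4⟩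
    -- For a real number that is not an eigenvalue the empty system serves, so the union may run
    -- over all of `ℝ`.
    · refine ⟨∅, Set.empty_subset _, ⟨by simp, by simp⟩, by simp, fun x hx => ?_⟩
      have hx0 : x = 0 := by_contra fun h0 => h ⟨x, h0, hx⟩
      rw [hx0]
      exact (octSpan ∅).zero_mem
  choose S hcone hon hev hspan using hex
  have hex2 (z : ⋃ μ, S μ) : ∃ μ, (z : H) ∈ S μ := Set.mem_iUnion.1 z.2
  choose lam hlam using hex2
  have hBcone : (⋃ μ, S μ) ⊆ sliceCone H := Set.iUnion_subset hcone
  have hB : IsWeakAssocOrthonormal (⋃ μ, S μ) := by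
    refine IsOctOrthonormal.isWeakAssocOrthonormal ⟨fun z hz => ?_, fun z hz w hw hzw => ?_⟩ hBcone
    · obtain ⟨μ, hμ⟩ := Set.mem_iUnion.1 hz
      exact (hon μ).1 z hμ
    · obtain ⟨μ, hμ⟩ := Set.mem_iUnion.1 hz
      obtain ⟨ν, hν⟩ := Set.mem_iUnion.1 hw
      by_cases h : μ = ν
      · exact (hon μ).2 z hμ w (h ▸ hν) hzw
      · exact oinner_eq_zero_of_eigenvectors hT_para hTs (hcone μ hμ) (hcone ν hν) h
          (hev μ z hμ) (hev ν w hν)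
  refine ⟨⋃ μ, S μ, lam, hB.maximal_of_octSpan_eq_top ?_, hBcone, fun z => hev _ _ (hlam z)⟩
  have hle : (⨆ μ, Module.End.eigenspace (T : Module.End ℝ H) μ) ≤ octSpan (⋃ μ, S μ) := by
    refine iSup_le fun μ x hx => ?_
    have hmono : octSpan (S μ) ≤ octSpan (⋃ μ, S μ) := by
      refine topologicalClosure_span_le (isClosed_octSpan _) ?_
      rintro _ ⟨z, hz, p, rfl⟩
      exact rmul_mem_octSpan (Set.mem_iUnion.2 ⟨μ, hz⟩) p
    exact hmono (hspan μ x (Module.End.mem_eigenspace_iff.1 hx))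
  -- The spectral theorem for compact symmetric operators on the underlying real Hilbert space;
  -- density of the eigenspaces yields a complete, hence maximal, system.
  have horth := ContinuousLinearMap.orthogonalComplement_iSup_eigenspaces_eq_bot hT_compact hTs
  have : CompleteSpace (octSpan (⋃ μ, S μ)) := (isClosed_octSpan _).completeSpace_coe
  rw [← Submodule.orthogonal_eq_bot_iff, eq_bot_iff, ← horth]
  exact Submodule.orthogonal_le hle

end Existence

/-! ### Slice projections and real diagonal operators. -/

section SliceProjections

open Octonion OctBimodule HilbertOctBimodule

lemma Octonion.abs_coord_le (p : Octonion) (i : Fin 8) : |(p * (e i).conj).c0| ≤ p.abs := by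
  refine Real.abs_le_sqrt ?_
  change _ ≤ (p * p.conj).c0
  rw [mul_conj_re]
  have h0 := sq_nonneg p.c0
  have h1 := sq_nonneg p.c1
  have h2 := sq_nonneg p.c2
  have h3 := sq_nonneg p.c3
  have h4 := sq_nonneg p.c4
  have h5 := sq_nonneg p.c5
  have h6 := sq_nonneg p.c6
  have h7 := sq_nonneg p.c7
  fin_cases i <;> simp [mul_def, conj, e] <;> linarith

variable {H : Type*} [NormedAddCommGroup H] [InnerProductSpace ℝ H] [HilbertOctBimodule H]
  {J : Octonion}

lemma sliceProj_apply (z x : H) : sliceProj z x = rmul z (oinner z x) := rfl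

/-- Expands `P_z` along the vectors `z eᵢ`, which makes its real symmetry visible and links it to
the real Hilbert basis below. -/
lemma sliceProj_eq_sum (z x : H) :
    sliceProj z x = ∑ i, (inner ℝ (rmul z (e i)) x : ℝ) • rmul z (e i) := by
  rw [sliceProj_apply, oinner_eq_sum]
  simp only [map_sum, map_smul, ← inner_rmul_left]

lemma sliceProj_symm (z x y : H) : inner ℝ (sliceProj z x) y = inner ℝ x (sliceProj z y) := by
  simp only [sliceProj_eq_sum, sum_inner, inner_sum, inner_smul_left, inner_smul_right]
  refine Finset.sum_congr rfl fun i _ => ?_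
  rw [real_inner_comm x]
  simp [mul_comm]

lemma sliceProj_mem_slice (hJ : J.c0 = 0) (hJ1 : J.abs = 1) {z y : H} (hz : z ∈ slice H J)
    (hy : y ∈ slice H J) : sliceProj z y ∈ slice H J := by
  rw [sliceProj_apply, oinner_of_mem_slice hJ hJ1 hz hy, map_add, map_smul, map_smul, rmul_one]
  exact (slice H J).add_mem ((slice H J).smul_mem _ hz)
    ((slice H J).smul_mem _ (rmul_imag_mem_slice hJ hJ1 hz))

lemma sliceProj_rmul (hJ : J.c0 = 0) (hJ1 : J.abs = 1) {z y : H} (hz : z ∈ slice H J)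
    (hy : y ∈ slice H J) (p : Octonion) : sliceProj z (rmul y p) = rmul (sliceProj z y) p := by
  rw [sliceProj_apply, sliceProj_apply, oinner_rmul_of_mem_slice hJ hJ1 hz hy,
    oinner_of_mem_slice hJ hJ1 hz hy]
  simp only [map_add, map_smul, add_mul, smul_mul_assoc, one_mul, LinearMap.add_apply,
    LinearMap.smul_apply, rmul_one, rmul_imag_rmul hJ hJ1 hz]

lemma isParaLinear_sliceProj {z : H} (hz : z ∈ sliceCone H) : IsParaLinear (sliceProj z) := by
  obtain ⟨J, hJ, hJ1, hz⟩ := mem_sliceCone_iff.1 hz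
  exact isParaLinear_iff.2 fun v hv p => sliceProj_rmul hJ hJ1 hz (octRe_subset_slice hv) p

lemma IsParaLinear.of_hasSum {ι : Type*} {f : ι → H →ₗ[ℝ] H} {g : H →L[ℝ] H}
    (hf : ∀ i, IsParaLinear (f i)) (h : ∀ x, HasSum (fun i => f i x) (g x)) :
    IsParaLinear (g : H →ₗ[ℝ] H) := by
  refine isParaLinear_iff.2 fun v hv p => ?_
  have h1 := (h v).mapL (rmulL p)
  simp only [rmulL_apply, ← (hf _).map_rmul hv] at h1
  exact (h _).unique h1

/-- A complete weak associative orthonormal system in the slice cone. -/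
structure IsSliceBasis (B : Set H) : Prop where
  orthonormal : IsWeakAssocOrthonormal B
  subset_sliceCone : B ⊆ sliceCone H
  octSpan_eq_top : octSpan B = ⊤

lemma IsEigenbasis.isSliceBasis [CompleteSpace H] {T : H →L[ℝ] H} {B : Set H} {lam : B → ℝ}
    (h : IsEigenbasis T B lam) : IsSliceBasis B :=
  ⟨h.1.1, h.2.1, octSpan_eq_top_of_maximal h.1 h.2.1⟩

namespace IsSliceBasis

variable {B : Set H}

lemma isParaLinear (hB : IsSliceBasis B) (z : B) : IsParaLinear (sliceProj (z : H)) :=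
  isParaLinear_sliceProj (hB.subset_sliceCone z.2)

lemma sliceProj_rmul_self (hB : IsSliceBasis B) (z : B) (p : Octonion) :
    sliceProj (z : H) (rmul (z : H) p) = rmul (z : H) p := by
  rw [sliceProj_apply, hB.orthonormal.oinner_rmul_self z.2]

lemma sliceProj_rmul_of_ne (hB : IsSliceBasis B) {z w : B} (h : z ≠ w) (p : Octonion) :
    sliceProj (z : H) (rmul (w : H) p) = 0 := by
  rw [sliceProj_apply, hB.orthonormal.oinner_rmul_of_ne z.2 w.2 (Subtype.coe_ne_coe.2 h), map_zero]

lemma sliceProj_sliceProj_self (hB : IsSliceBasis B) (z : B) (x : H) :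
    sliceProj (z : H) (sliceProj (z : H) x) = sliceProj (z : H) x :=
  hB.sliceProj_rmul_self z _

lemma sliceProj_sliceProj_of_ne (hB : IsSliceBasis B) {z w : B} (h : z ≠ w) (x : H) :
    sliceProj (z : H) (sliceProj (w : H) x) = 0 :=
  hB.sliceProj_rmul_of_ne h _

/-- Weak associativity gives `⟨z, w p⟩ = ⟨z, w⟩ p`, so the real inner products of the `z eᵢ` are
those of the standard basis of `𝕆`. -/
lemma orthonormal_rmul (hB : IsSliceBasis B) :
    Orthonormal ℝ (fun k : B × Fin 8 => rmul (k.1 : H) (e k.2)) := by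
  classical
  rw [orthonormal_iff_ite]
  rintro ⟨z, i⟩ ⟨w, j⟩
  simp only [Prod.mk.injEq]
  rw [inner_rmul_left, ← oinner_mul_re]
  by_cases h : z = w
  · subst h
    rw [hB.orthonormal.oinner_rmul_self z.2]
    fin_cases i <;> fin_cases j <;> simp [mul_def, conj, e]
  · rw [hB.orthonormal.oinner_rmul_of_ne z.2 w.2 (Subtype.coe_ne_coe.2 h), zero_mul, zero_c0,
      if_neg fun h' => h h'.1]

lemma top_le_span (hB : IsSliceBasis B) :
    ⊤ ≤ (Submodule.span ℝ (Set.range fun k : B × Fin 8 =>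
      rmul (k.1 : H) (e k.2))).topologicalClosure := by
  rw [← hB.octSpan_eq_top]
  refine Submodule.topologicalClosure_mono (Submodule.span_le.2 ?_)
  rintro _ ⟨z, hz, p, rfl⟩
  rw [← sum_mul_conj_e p, map_sum]
  refine Submodule.sum_mem _ fun i _ => ?_
  rw [map_smul]
  exact Submodule.smul_mem _ _ (Submodule.subset_span ⟨(⟨z, hz⟩, i), rfl⟩)

variable [CompleteSpace H]

/-- The real operator that is diagonal with respect to a slice basis. -/
theorem exists_diagonal (hB : IsSliceBasis B) {g : B → ℝ} {C : ℝ} (hC : 0 ≤ C) (hg : ∀ z, |g z| ≤ C) :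
    ∃ D : H →L[ℝ] H, (∀ x, HasSum (fun z : B => g z • sliceProj (z : H) x) (D x)) ∧ ‖D‖ ≤ C := by
  set b : HilbertBasis (B × Fin 8) ℝ H := HilbertBasis.mk hB.orthonormal_rmul hB.top_le_span
    with hb
  have hbk (k : B × Fin 8) : b k = rmul (k.1 : H) (e k.2) := by
    rw [hb, HilbertBasis.coe_mk]
  set m := lp.mapCLM (E := fun _ : B × Fin 8 => ℝ) (F := fun _ : B × Fin 8 => ℝ) (𝕜 := ℝ) 2
    (fun k => g k.1 • ContinuousLinearMap.id ℝ ℝ) hC (fun k => by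
      rw [norm_smul, ContinuousLinearMap.norm_id, mul_one]; exact hg k.1) with hm
  have hmk (f : lp (fun _ : B × Fin 8 => ℝ) 2) (k : B × Fin 8) : m f k = g k.1 * f k := rfl
  refine ⟨b.repr.symm.toContinuousLinearEquiv.toContinuousLinearMap ∘L m ∘L
    b.repr.toContinuousLinearEquiv.toContinuousLinearMap, fun x => ?_, ?_⟩
  · have h := b.hasSum_repr_symm (m (b.repr x))
    refine h.prod_fiberwise fun z => ?_
    rw [sliceProj_eq_sum, Finset.smul_sum]
    convert hasSum_fintype _ using 2 with i
    simp only [hmk, b.repr_apply_apply, hbk, smul_smul]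
  · refine ContinuousLinearMap.opNorm_le_bound _ hC fun x => ?_
    change ‖b.repr.symm (m (b.repr x))‖ ≤ _
    rw [LinearIsometryEquiv.norm_map, ← b.repr.norm_map x]
    exact m.le_of_opNorm_le (lp.norm_mapCLM_le 2 _ hC _) _

lemma hasSum_sliceProj (hB : IsSliceBasis B) (x : H) : HasSum (fun z : B => sliceProj (z : H) x) x := by
  obtain ⟨D, hD, -⟩ := hB.exists_diagonal (g := fun _ => 1) zero_le_one (by simp)
  simp only [one_smul] at hD
  -- The sum with all coefficients `1` fixes the octonion multiples of the basis, and its fixed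
  -- space is closed.
  have h : IsClosed ((LinearMap.ker (D - ContinuousLinearMap.id ℝ H).toLinearMap : Submodule ℝ H) : Set H) :=
    (D - ContinuousLinearMap.id ℝ H).isClosed_ker
  have h1 : octSpan B ≤ LinearMap.ker (D - ContinuousLinearMap.id ℝ H).toLinearMap := by
    refine topologicalClosure_span_le h ?_
    rintro _ ⟨w, hw, p, rfl⟩
    have h2 : HasSum (fun z : B => sliceProj (z : H) (rmul w p)) (rmul w p) := by
      have h3 := hasSum_single (f := fun z : B => sliceProj (z : H) (rmul w p)) ⟨w, hw⟩
        fun z hz => hB.sliceProj_rmul_of_ne hz p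
      rwa [hB.sliceProj_rmul_self ⟨w, hw⟩] at h3
    exact sub_eq_zero.2 ((hD _).unique h2)
  have h2 : D x - x = 0 := h1 (hB.octSpan_eq_top ▸ Submodule.mem_top)
  rw [← sub_eq_zero.1 h2]
  convert hD x using 1
  rw [sub_eq_zero.1 h2]

end IsSliceBasis

/-! ### Octonionic coefficients: expansion in coordinates and convergence. -/

section Multiples

variable {M : Type*} [AddCommGroup M] [Module ℝ M] [OctBimodule M]

lemma octRSmul_add_right (f : M →ₗ[ℝ] M) (p q : Octonion) (x : M) :
    octRSmul f (p + q) x = octRSmul f p x + octRSmul f q x := by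
  simp only [octRSmul_apply, map_add, LinearMap.add_apply]
  abel

lemma octRSmul_smul_right (f : M →ₗ[ℝ] M) (r : ℝ) (p : Octonion) (x : M) :
    octRSmul f (r • p) x = r • octRSmul f p x := by
  simp only [octRSmul_apply, map_smul, LinearMap.smul_apply, smul_sub]

lemma octRSmul_one (f : M →ₗ[ℝ] M) (x : M) : octRSmul f 1 x = f x := by
  rw [octRSmul_apply, one_lmul, rmul_one, rmul_one, sub_self, sub_zero]

lemma octLSmul_add_left (f : M →ₗ[ℝ] M) (p q : Octonion) (x : M) :
    octLSmul (p + q) f x = octLSmul p f x + octLSmul q f x := by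
  simp only [octLSmul_apply, map_add, LinearMap.add_apply]
  abel

lemma octLSmul_smul_left (f : M →ₗ[ℝ] M) (r : ℝ) (p : Octonion) (x : M) :
    octLSmul (r • p) f x = r • octLSmul p f x := by
  simp only [octLSmul_apply, map_smul, LinearMap.smul_apply, smul_sub, smul_add]

lemma octLSmul_one (f : M →ₗ[ℝ] M) (x : M) : octLSmul 1 f x = f x := by
  rw [octLSmul_apply, one_lmul, rmul_one, rmul_one, sub_self, add_zero]

lemma octRSmul_eq_sum (f : M →ₗ[ℝ] M) (p : Octonion) (x : M) :
    octRSmul f p x = ∑ i, (p * (e i).conj).c0 • octRSmul f (e i) x := by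
  let L : Octonion →ₗ[ℝ] M := ⟨⟨fun p => octRSmul f p x, fun p q => octRSmul_add_right f p q x⟩,
    fun r p => octRSmul_smul_right f r p x⟩
  have h := congrArg L (sum_mul_conj_e p)
  rw [map_sum] at h
  simp only [map_smul] at h
  exact h.symm

lemma octLSmul_eq_sum (f : M →ₗ[ℝ] M) (p : Octonion) (x : M) :
    octLSmul p f x = ∑ i, (p * (e i).conj).c0 • octLSmul (e i) f x := by
  let L : Octonion →ₗ[ℝ] M := ⟨⟨fun p => octLSmul p f x, fun p q => octLSmul_add_left f p q x⟩,
    fun r p => octLSmul_smul_left f r p x⟩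
  have h := congrArg L (sum_mul_conj_e p)
  rw [map_sum] at h
  simp only [map_smul] at h
  exact h.symm

end Multiples

namespace IsSliceBasis

variable {B : Set H} [CompleteSpace H]

/-- Expanding the coefficients in the eight coordinates and using `octRSmul_e_apply` splits the
series into eight real diagonal operators between isometries, each of norm at most `C`. This is the
origin of the factor `8`. -/
theorem exists_right (hB : IsSliceBasis B) {F : B → Octonion} {C : ℝ} (hC : 0 ≤ C) (hF : ∀ z, (F z).abs ≤ C) :
    ∃ D : H →L[ℝ] H, (∀ x, HasSum (fun z : B => octRSmul (sliceProj (z : H)) (F z) x) (D x)) ∧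
      ‖D‖ ≤ 8 * C := by
  choose D hD hDC using fun i : Fin 8 => hB.exists_diagonal (g := fun z => (F z * (e i).conj).c0)
    hC fun z => (abs_coord_le _ _).trans (hF z)
  refine ⟨∑ i, rmulL (e i).conj ∘L D i ∘L rmulL (e i) ∘L lmulL (e i), fun x => ?_, ?_⟩
  · rw [sum_apply]
    rw [funext fun z => octRSmul_eq_sum (sliceProj (z : B).1) (F z) x]
    refine hasSum_sum fun i _ => ?_
    have h := (hD i (rmul (lmul (e i) x) (e i))).mapL (rmulL (e i).conj)
    simp only [map_smul, rmulL_apply, ← (hB.isParaLinear _).octRSmul_e_apply] at h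
    exact h
  · refine (norm_sum_le _ _).trans ((Finset.sum_le_card_nsmul _ _ C fun i _ => ?_).trans_eq ?_)
    · refine ContinuousLinearMap.opNorm_le_bound _ hC fun x => ?_
      change ‖rmul (D i (rmul (lmul (e i) x) (e i))) (e i).conj‖ ≤ _
      rw [norm_rmul, abs_conj_e, one_mul]
      refine ((D i).le_of_opNorm_le (hDC i) _).trans_eq ?_
      rw [norm_rmul, norm_lmul, abs_e, one_mul, one_mul]
    · simp

theorem exists_left (hB : IsSliceBasis B) {F : B → Octonion} {C : ℝ} (hC : 0 ≤ C) (hF : ∀ z, (F z).abs ≤ C) :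
    ∃ D : H →L[ℝ] H, (∀ x, HasSum (fun z : B => octLSmul (F z) (sliceProj (z : H)) x) (D x)) ∧
      ‖D‖ ≤ 8 * C := by
  choose D hD hDC using fun i : Fin 8 => hB.exists_diagonal (g := fun z => (F z * (e i).conj).c0)
    hC fun z => (abs_coord_le _ _).trans (hF z)
  refine ⟨∑ i, rmulL (e i) ∘L lmulL (e i) ∘L D i ∘L rmulL (e i).conj, fun x => ?_, ?_⟩
  · rw [sum_apply]
    rw [funext fun z => octLSmul_eq_sum (sliceProj (z : B).1) (F z) x]
    refine hasSum_sum fun i _ => ?_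
    have h := (hD i (rmul x (e i).conj)).mapL (rmulL (e i) ∘L lmulL (e i))
    simp only [map_smul, ContinuousLinearMap.comp_apply, rmulL_apply, lmulL_apply,
      ← (hB.isParaLinear _).octLSmul_e_apply] at h
    exact h
  · refine (norm_sum_le _ _).trans ((Finset.sum_le_card_nsmul _ _ C fun i _ => ?_).trans_eq ?_)
    · refine ContinuousLinearMap.opNorm_le_bound _ hC fun x => ?_
      change ‖rmul (lmul (e i) (D i (rmul x (e i).conj))) (e i)‖ ≤ _
      rw [norm_rmul, norm_lmul, abs_e, one_mul, one_mul]
      refine ((D i).le_of_opNorm_le (hDC i) _).trans_eq ?_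
      rw [norm_rmul, abs_conj_e, one_mul]
    · simp

end IsSliceBasis

end SliceProjections

/-! ### The left and right sums, and adjoints. -/

section FunctionalCalculus

open Octonion OctBimodule HilbertOctBimodule

lemma Octonion.abs_smul_one (r : ℝ) : (r • (1 : Octonion)).abs = |r| := by
  rw [← Real.sqrt_sq_eq_abs, Octonion.abs]
  congr 1
  change (_ : Octonion).c0 = _
  rw [mul_conj_re]
  simp [smul_def, one_def]

section Bimodule

variable {M : Type*} [AddCommGroup M] [Module ℝ M] [OctBimodule M] {f : M →ₗ[ℝ] M}

lemma octRePart_lmul_lmul (x : M) (p q : Octonion) :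
    octRePart (lmul p (lmul q x)) = octRePart (lmul (p * q) x) := by
  induction x using octRe_induction with
  | hadd x y hx hy => simp only [map_add, hx, hy]
  | h v hv a => simp only [lmul_rmul_of_mem hv, octRePart_rmul_of_mem hv, re_mul_mul]

lemma IsParaLinear.octRePart_octLSmul (hf : IsParaLinear f) (p : Octonion) (x : M) :
    octRePart (_root_.octLSmul p f x) = octRePart (lmul p (f x)) := by
  rw [octLSmul_apply, map_add, map_sub, hf.octRePart_map_rmul, sub_self, add_zero]

lemma IsParaLinear.octOpRe_eq_zero (hf : IsParaLinear f)
    (h : ∀ v ∈ octRe M, octRePart (f v) = 0) : _root_.octOpRe f = 0 :=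
  hf.octOpRe.ext (isParaLinear_iff.2 fun _ _ _ => by simp) fun v hv => by
    rw [hf.octOpRe_of_mem hv, h v hv, LinearMap.zero_apply]

/-- A commutator with `J` is imaginary and orthogonal to `J`, so neither component of a slice vector
contributes a real part. -/
lemma octRePart_rmul_commutator {J : Octonion} (hJ : J.c0 = 0) (hJ1 : J.abs = 1) {x : M}
    (hx : x ∈ slice M J) (p : Octonion) : octRePart (rmul x (p * J - J * p)) = 0 := by
  obtain ⟨u, hu, v, hv, rfl⟩ := exists_of_mem_slice hJ hJ1 hx
  rw [map_add, LinearMap.add_apply, map_add, rmul_rmul_of_mem hv, octRePart_rmul_of_mem hu,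
    octRePart_rmul_of_mem hv]
  have h1 : (p * J - J * p).c0 = 0 := by simp only [sub_def, mul_def]; ring
  have h2 : (J * (p * J - J * p)).c0 = 0 := by simp only [sub_def, mul_def]; ring
  rw [h1, h2, zero_smul, zero_smul, add_zero]

end Bimodule

variable {H : Type*} [NormedAddCommGroup H] [InnerProductSpace ℝ H] [HilbertOctBimodule H]

/-- `A` is the sum of the operators `P_z ⊙ F z`. -/
def HasRightSum (B : Set H) (F : B → Octonion) (A : H →L[ℝ] H) : Prop :=
  ∀ x : H, HasSum (fun z : B => octRSmul (sliceProj (z : H)) (F z) x) (A x)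

/-- `A` is the sum of the operators `F z ⊙ P_z`. -/
def HasLeftSum (B : Set H) (F : B → Octonion) (A : H →L[ℝ] H) : Prop :=
  ∀ x : H, HasSum (fun z : B => octLSmul (F z) (sliceProj (z : H)) x) (A x)

/-- The adjoint of `P_z ⊙ p` is `p̄ ⊙ P_z`; summed over the basis this is the involution property.
-/
lemma inner_octRSmul_sliceProj (z x y : H) (p : Octonion) :
    inner ℝ (octRSmul (sliceProj z) p y) x = inner ℝ y (octLSmul p.conj (sliceProj z) x) := by
  simp only [octRSmul_apply, octLSmul_apply, inner_sub_left, inner_add_right, inner_sub_right,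
    sliceProj_symm, inner_lmul_left, inner_rmul_left]
  ring

variable {B : Set H} {F G : B → Octonion} {A A' : H →L[ℝ] H}

namespace HasRightSum

lemma unique (h : HasRightSum B F A) (h' : HasRightSum B F A') : A = A' :=
  ContinuousLinearMap.ext fun x => (h x).unique (h' x)

lemma add (h : HasRightSum B F A) (h' : HasRightSum B G A') :
    HasRightSum B (fun z => F z + G z) (A + A') := fun x => by
  simp only [octRSmul_add_right]
  exact (h x).add (h' x)

lemma smul (h : HasRightSum B F A) (r : ℝ) : HasRightSum B (fun z => r • F z) (r • A) := fun x => by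
  simp only [octRSmul_smul_right]
  exact (h x).const_smul r

lemma isParaLinear (h : HasRightSum B F A) (hB : IsSliceBasis B) :
    IsParaLinear (A : H →ₗ[ℝ] H) :=
  .of_hasSum (fun z => (hB.isParaLinear z).octRSmul (F z)) h

lemma of_mem (h : HasRightSum B F A) (hB : IsSliceBasis B) {v : H} (hv : v ∈ octRe H) :
    HasSum (fun z : B => rmul (sliceProj (z : H) v) (F z)) (A v) := by
  simpa only [(hB.isParaLinear _).octRSmul_of_mem _ hv] using h v

lemma isOctAdjoint (h : HasRightSum B F A) (h' : HasLeftSum B (fun z => (F z).conj) A') :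
    IsOctAdjoint A' A := by
  refine isOctAdjoint_iff.2 fun x y => ?_
  have h1 := (h y).mapL (innerSL ℝ x)
  have h2 := (h' x).mapL (innerSL ℝ y)
  simp only [innerSL_apply_apply, real_inner_comm x, ← inner_octRSmul_sliceProj] at h1 h2
  rw [real_inner_comm]
  exact h1.unique h2

lemma isOctAdjoint' (h : HasRightSum B F A) (h' : HasLeftSum B (fun z => (F z).conj) A') :
    IsOctAdjoint A A' := by
  refine isOctAdjoint_iff.2 fun x y => ?_
  rw [real_inner_comm, real_inner_comm (A x) y]
  exact (isOctAdjoint_iff.1 (h.isOctAdjoint h') y x).symm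

end HasRightSum

namespace HasLeftSum

lemma unique (h : HasLeftSum B F A) (h' : HasLeftSum B F A') : A = A' :=
  ContinuousLinearMap.ext fun x => (h x).unique (h' x)

lemma add (h : HasLeftSum B F A) (h' : HasLeftSum B G A') :
    HasLeftSum B (fun z => F z + G z) (A + A') := fun x => by
  simp only [octLSmul_add_left]
  exact (h x).add (h' x)

lemma smul (h : HasLeftSum B F A) (r : ℝ) : HasLeftSum B (fun z => r • F z) (r • A) := fun x => by
  simp only [octLSmul_smul_left]
  exact (h x).const_smul r

lemma isParaLinear (h : HasLeftSum B F A) (hB : IsSliceBasis B) :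
    IsParaLinear (A : H →ₗ[ℝ] H) :=
  .of_hasSum (fun z => (hB.isParaLinear z).octLSmul (F z)) h

lemma of_mem (h : HasLeftSum B F A) (hB : IsSliceBasis B) {v : H} (hv : v ∈ octRe H) :
    HasSum (fun z : B => lmul (F z) (sliceProj (z : H) v)) (A v) := by
  simpa only [(hB.isParaLinear _).octLSmul_of_mem _ hv] using h v

lemma octRePart (h : HasLeftSum B F A) (hB : IsSliceBasis B) (x : H) :
    HasSum (fun z : B => octRePart (lmul (F z) (sliceProj (z : H) x))) (_root_.octRePart (A x)) := by
  simpa only [octRePartL_apply, (hB.isParaLinear _).octRePart_octLSmul] using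
    (h x).mapL (octRePartL H)

/-- For real coefficients the left and right sums agree. -/
lemma hasRightSum (h : HasLeftSum B F A) (hF : ∀ z, (F z).IsReal) : HasRightSum B F A := fun x => by
  convert h x using 2 with z
  obtain ⟨r, hr⟩ := hF z
  rw [hr, octRSmul_smul_right, octLSmul_smul_left, octRSmul_one, octLSmul_one]

end HasLeftSum

namespace HasRightSum

variable {r : B → ℝ}

lemma hasSum_smul (h : HasRightSum B (fun z => r z • (1 : Octonion)) A) (x : H) :
    HasSum (fun z : B => r z • sliceProj (z : H) x) (A x) := by
  simpa only [octRSmul_smul_right, octRSmul_one] using h x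

lemma apply_sliceProj (h : HasRightSum B (fun z => r z • (1 : Octonion)) A) (hB : IsSliceBasis B)
    (w : B) (x : H) : A (sliceProj (w : H) x) = r w • sliceProj (w : H) x := by
  refine (h.hasSum_smul _).unique ?_
  have h3 := hasSum_single (f := fun z : B => r z • sliceProj (z : H) (sliceProj (w : H) x)) w
    fun z hz => by rw [hB.sliceProj_sliceProj_of_ne hz, smul_zero]
  rwa [hB.sliceProj_sliceProj_self w] at h3

/-- Real coefficients give a diagonal operator in the real Hilbert basis, so no factor `8` is lost.
-/
lemma norm_le [CompleteSpace H] (h : HasRightSum B F A) (hB : IsSliceBasis B)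
    (hF : ∀ z, (F z).IsReal) {C : ℝ} (hC : 0 ≤ C) (hFC : ∀ z, (F z).abs ≤ C) : ‖A‖ ≤ C := by
  choose r hr using hF
  obtain rfl : F = fun z => r z • (1 : Octonion) := funext hr
  obtain ⟨D, hD, hDC⟩ := hB.exists_diagonal (g := r) hC fun z => by
    rw [← abs_smul_one]; exact hFC z
  have hAD : A = D := ContinuousLinearMap.ext fun x => (h.hasSum_smul x).unique (hD x)
  rwa [hAD]

end HasRightSum

/-- The projection `P_w v` of a real element `v` has the form `a + b J` with `a`, `b` real, where
all projections of `b` lie in the slice of `J`. -/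
lemma IsSliceBasis.exists_sliceProj_eq (hB : IsSliceBasis B) (w : B) {v : H} (hv : v ∈ octRe H) :
    ∃ J : Octonion, J.c0 = 0 ∧ J.abs = 1 ∧ ∃ a ∈ octRe H, ∃ b ∈ octRe H,
      sliceProj (w : H) v = a + rmul b J ∧ ∀ z : B, sliceProj (z : H) b ∈ slice H J := by
  obtain ⟨J, hJ, hJ1, hw⟩ := mem_sliceCone_iff.1 (hB.subset_sliceCone w.2)
  obtain ⟨u, hu, u', hu', huu'⟩ := exists_of_mem_slice hJ hJ1 hw
  have hJv := octRe_subset_slice (J := J) hv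
  set α : ℝ := inner ℝ (w : H) v
  set β : ℝ := inner ℝ (rmul (w : H) J) v
  have hP : sliceProj (w : H) v = α • (w : H) + β • rmul (w : H) J := by
    rw [sliceProj_apply, oinner_of_mem_slice hJ hJ1 hw hJv, map_add, map_smul, map_smul, rmul_one]
  have hb : α • u' + β • u ∈ octRe H := (octReSubmodule H).add_mem
    ((octReSubmodule H).smul_mem _ hu') ((octReSubmodule H).smul_mem _ hu)
  refine ⟨J, hJ, hJ1, α • u - β • u', (octReSubmodule H).sub_mem
    ((octReSubmodule H).smul_mem _ hu) ((octReSubmodule H).smul_mem _ hu'), α • u' + β • u, hb,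
    ?_, fun z => ?_⟩
  · rw [hP, huu']
    simp only [map_add, map_smul, LinearMap.add_apply, LinearMap.smul_apply, rmul_rmul_of_mem hu',
      imag_mul_self hJ hJ1, map_neg, rmul_one]
    module
  · rcases hB.orthonormal.mem_slice_or hB.subset_sliceCone hJ hJ1 hu hu' (huu' ▸ w.2) z.2 with
      h | ⟨h1, h2⟩
    · exact sliceProj_mem_slice hJ hJ1 h (octRe_subset_slice hb)
    · rw [sliceProj_apply, map_add, map_smul, map_smul, h1, h2, smul_zero, smul_zero, add_zero,
        map_zero]
      exact (slice H J).zero_mem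

/-- Para-linearity controls `A (y p)` up to real part, but not `A (p y)`. For `y = P_w v = a + b J`
one has `p y = y p + b (pJ - Jp)`; since every `P_z b` lies in the slice of `J`, the real part of
`A` on the correction vanishes term by term. -/
lemma HasRightSum.octRePart_apply_lmul {r : B → ℝ}
    (h : HasRightSum B (fun z => r z • (1 : Octonion)) A) (hB : IsSliceBasis B) (w : B) {v : H}
    (hv : v ∈ octRe H) (p : Octonion) :
    octRePart (A (lmul p (sliceProj (w : H) v))) =
      octRePart (lmul (r w • p) (sliceProj (w : H) v)) := by
  have hA := h.isParaLinear hB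
  obtain ⟨J, hJ, hJ1, a, ha, b, hb, hab, hslice⟩ := hB.exists_sliceProj_eq w hv
  have h1 : lmul p (sliceProj (w : H) v) =
      rmul (sliceProj (w : H) v) p + rmul b (p * J - J * p) := by
    rw [hab, map_add, lmul_rmul_of_mem hb, lmul_of_mem ha, map_add, LinearMap.add_apply,
      rmul_rmul_of_mem hb, map_sub]
    abel
  have h2 : octRePart (A (rmul b (p * J - J * p))) = 0 := by
    have h3 := (((h.hasSum_smul b).mapL (rmulL (p * J - J * p))).mapL (octRePartL H))
    simp only [octRePartL_apply, rmulL_apply, map_smul,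
      octRePart_rmul_commutator hJ hJ1 (hslice _), smul_zero] at h3
    have h4 := hA.octRePart_map_rmul b (p * J - J * p)
    rw [ContinuousLinearMap.coe_coe] at h4
    rw [h4]
    exact h3.unique hasSum_zero
  have h5 := hA.octRePart_map_rmul (sliceProj (w : H) v) p
  rw [ContinuousLinearMap.coe_coe] at h5
  rw [h1, map_add, map_add, h2, add_zero, h5, h.apply_sliceProj hB, octRePart_lmul, map_smul,
    map_smul, LinearMap.smul_apply]

/-! ### Multiplicativity of the real part and para-linearity of the calculi. -/

section Multiplicativity

variable {A₁ A₂ A₃ : H →L[ℝ] H}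

lemma HasRightSum.octOpRe_mul (h₁ : HasRightSum B F A₁) (h₂ : HasRightSum B G A₂)
    (h₃ : HasRightSum B (fun z => F z * G z) A₃) (hB : IsSliceBasis B) (hF : ∀ z, (F z).IsReal) :
    octOpRe (A₃ : H →ₗ[ℝ] H) = octOpRe (octComp (A₁ : H →ₗ[ℝ] H) (A₂ : H →ₗ[ℝ] H)) := by
  choose r hr using hF
  obtain rfl : F = fun z => r z • (1 : Octonion) := funext hr
  have p₁ := h₁.isParaLinear hB
  have p₂ := h₂.isParaLinear hB
  refine (h₃.isParaLinear hB).octOpRe_eq (p₁.octComp p₂) fun v hv => ?_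
  rw [p₁.octComp_of_mem p₂ hv]
  refine ((h₃.of_mem hB hv).mapL (octRePartL H)).unique ?_
  change HasSum _ (octRePartL H (A₁ (A₂ v)))
  convert ((h₂.of_mem hB hv).mapL A₁).mapL (octRePartL H) using 2 with w
  have h := p₁.octRePart_map_rmul (sliceProj (w : H) v) (G w)
  rw [ContinuousLinearMap.coe_coe] at h
  rw [octRePartL_apply, octRePartL_apply, h, h₁.apply_sliceProj hB]
  simp only [map_smul, LinearMap.smul_apply, smul_mul_assoc, one_mul]

lemma HasLeftSum.octOpRe_mul_of_right (h₁ : HasLeftSum B F A₁) (h₂ : HasLeftSum B G A₂)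
    (h₃ : HasLeftSum B (fun z => F z * G z) A₃) (hB : IsSliceBasis B) (hG : ∀ z, (G z).IsReal) :
    octOpRe (A₃ : H →ₗ[ℝ] H) = octOpRe (octComp (A₁ : H →ₗ[ℝ] H) (A₂ : H →ₗ[ℝ] H)) := by
  choose r hr using hG
  obtain rfl : G = fun z => r z • (1 : Octonion) := funext hr
  have p₁ := h₁.isParaLinear hB
  have p₂ := h₂.isParaLinear hB
  refine (h₃.isParaLinear hB).octOpRe_eq (p₁.octComp p₂) fun v hv => ?_
  rw [p₁.octComp_of_mem p₂ hv]
  refine (h₃.octRePart hB v).unique ?_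
  change HasSum _ (octRePartL H (A₁ (A₂ v)))
  convert ((h₂.of_mem hB hv).mapL A₁).mapL (octRePartL H) using 2 with w
  -- On the range of `P_w` only the `w` term of the series for `A₁` has a nonzero real part.
  have h3 := (h₁.octRePart hB (sliceProj (w : H) v)).unique
    (hasSum_single w fun z hz => by rw [hB.sliceProj_sliceProj_of_ne hz, map_zero, map_zero])
  rw [hB.sliceProj_sliceProj_self] at h3
  simp only [octRePartL_apply, map_smul, LinearMap.smul_apply, mul_smul_comm, mul_one, one_lmul, h3]

lemma HasLeftSum.octOpRe_mul_of_left (h₁ : HasLeftSum B F A₁) (h₂ : HasLeftSum B G A₂)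
    (h₃ : HasLeftSum B (fun z => F z * G z) A₃) (hB : IsSliceBasis B) (hF : ∀ z, (F z).IsReal) :
    octOpRe (A₃ : H →ₗ[ℝ] H) = octOpRe (octComp (A₁ : H →ₗ[ℝ] H) (A₂ : H →ₗ[ℝ] H)) := by
  have h₁' := h₁.hasRightSum hF
  choose r hr using hF
  obtain rfl : F = fun z => r z • (1 : Octonion) := funext hr
  have p₁ := h₁.isParaLinear hB
  have p₂ := h₂.isParaLinear hB
  refine (h₃.isParaLinear hB).octOpRe_eq (p₁.octComp p₂) fun v hv => ?_
  rw [p₁.octComp_of_mem p₂ hv]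
  refine (h₃.octRePart hB v).unique ?_
  change HasSum _ (octRePartL H (A₁ (A₂ v)))
  convert ((h₂.of_mem hB hv).mapL A₁).mapL (octRePartL H) using 2 with w
  rw [octRePartL_apply, h₁'.octRePart_apply_lmul hB w hv, smul_mul_assoc, one_mul]

lemma HasRightSum.octOpRe_octRSmul_sub {p : Octonion} (h₁ : HasRightSum B F A₁)
    (h₂ : HasRightSum B (fun z => F z * p) A₂) (hB : IsSliceBasis B) :
    octOpRe (octRSmul (A₁ : H →ₗ[ℝ] H) p - (A₂ : H →ₗ[ℝ] H)) = 0 := by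
  have p₁ := h₁.isParaLinear hB
  refine ((p₁.octRSmul p).sub (h₂.isParaLinear hB)).octOpRe_eq_zero fun v hv => ?_
  rw [LinearMap.sub_apply, map_sub, p₁.octRSmul_of_mem p hv, sub_eq_zero]
  refine (((h₁.of_mem hB hv).mapL (rmulL p)).mapL (octRePartL H)).unique ?_
  change HasSum _ (octRePartL H (A₂ v))
  convert (h₂.of_mem hB hv).mapL (octRePartL H) using 2 with w
  rw [octRePartL_apply, octRePartL_apply, rmulL_apply, octRePart_rmul_rmul]

lemma HasLeftSum.octOpRe_octLSmul_sub {p : Octonion} (h₁ : HasLeftSum B F A₁)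
    (h₂ : HasLeftSum B (fun z => p * F z) A₂) (hB : IsSliceBasis B) :
    octOpRe (octLSmul p (A₁ : H →ₗ[ℝ] H) - (A₂ : H →ₗ[ℝ] H)) = 0 := by
  have p₁ := h₁.isParaLinear hB
  refine ((p₁.octLSmul p).sub (h₂.isParaLinear hB)).octOpRe_eq_zero fun v hv => ?_
  rw [LinearMap.sub_apply, map_sub, p₁.octLSmul_of_mem p hv, sub_eq_zero]
  refine (((h₁.of_mem hB hv).mapL (lmulL p)).mapL (octRePartL H)).unique ?_
  change HasSum _ (octRePartL H (A₂ v))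
  convert (h₂.of_mem hB hv).mapL (octRePartL H) using 2 with w
  rw [octRePartL_apply, octRePartL_apply, lmulL_apply, octRePart_lmul_lmul]

end Multiplicativity

/-! ### Powers of the operator. -/

section Powers

variable {T : H →L[ℝ] H} {lam : B → ℝ}

/-- For real `v` the coefficient `⟨z, v⟩` lies in `ℝ + ℝ J`, and on the slice of `z` the operator
commutes with right multiplication by `J`. For general `v` this argument fails, so powers are
compared on `Re H`. -/
lemma apply_sliceProj_of_eigenvector (hT : IsParaLinear (T : H →ₗ[ℝ] H)) {z v : H} {μ : ℝ}
    (hz : z ∈ sliceCone H) (hTz : T z = μ • z) (hv : v ∈ octRe H) :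
    T (sliceProj z v) = μ • sliceProj z v := by
  obtain ⟨J, hJ, hJ1, hz⟩ := mem_sliceCone_iff.1 hz
  have h := hT.map_rmul_imag hJ hJ1 hz
  rw [ContinuousLinearMap.coe_coe] at h
  rw [sliceProj_apply, oinner_of_mem_slice hJ hJ1 hz (octRe_subset_slice hv)]
  simp only [map_add, map_smul, rmul_one, h, hTz, LinearMap.smul_apply]
  module

lemma pow_apply_sliceProj_of_eigenvector (hT : IsParaLinear (T : H →ₗ[ℝ] H)) {z v : H} {μ : ℝ}
    (hz : z ∈ sliceCone H) (hTz : T z = μ • z) (hv : v ∈ octRe H) (k : ℕ) :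
    (T ^ k) (sliceProj z v) = μ ^ k • sliceProj z v := by
  induction k with
  | zero => simp
  | succ k ih =>
    rw [pow_succ', mul_apply_eq_comp, ih, map_smul,
      apply_sliceProj_of_eigenvector hT hz hTz hv, smul_smul, pow_succ]

lemma HasRightSum.apply_eq_pow [CompleteSpace H] {k : ℕ}
    (h : HasRightSum B (fun z => lam z ^ k • (1 : Octonion)) A)
    (hB : IsSliceBasis B) (hT : IsParaLinear (T : H →ₗ[ℝ] H))
    (hlam : ∀ z : B, T z = lam z • (z : H)) {v : H} (hv : v ∈ octRe H) : A v = (T ^ k) v := by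
  have h1 := (hB.hasSum_sliceProj v).mapL (T ^ k)
  simp only [fun z : B =>
    pow_apply_sliceProj_of_eigenvector hT (hB.subset_sliceCone z.2) (hlam z) hv k] at h1
  exact (h.hasSum_smul v).unique h1

lemma HasRightSum.eq_iff [CompleteSpace H] {k : ℕ}
    (h : HasRightSum B (fun z => lam z ^ k • (1 : Octonion)) A)
    (hB : IsSliceBasis B) (hT : IsParaLinear (T : H →ₗ[ℝ] H))
    (hlam : ∀ z : B, T z = lam z • (z : H)) (S : H →L[ℝ] H) :
    (IsParaLinear (S : H →ₗ[ℝ] H) ∧ ∀ x ∈ octRe H, S x = (T ^ k) x) ↔ S = A := by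
  refine ⟨fun ⟨h1, h2⟩ => ?_, ?_⟩
  · exact ContinuousLinearMap.coe_injective (h1.ext (h.isParaLinear hB) fun v hv =>
      (h2 v hv).trans (h.apply_eq_pow hB hT hlam hv).symm)
  · rintro rfl
    exact ⟨h.isParaLinear hB, fun v hv => h.apply_eq_pow hB hT hlam hv⟩

lemma IsEigenbasis.abs_le_norm (h : IsEigenbasis T B lam) (q : spectralSet lam) :
    |(q : ℝ)| ≤ ‖T‖ := by
  obtain ⟨q, ⟨z, rfl⟩ | rfl⟩ := q
  · have hz : ‖(z : H)‖ ≠ 0 := norm_ne_zero_iff.2 fun h0 => by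
      have h1 := h.1.1.1.1 z z.2
      rw [h0, map_zero] at h1
      exact zero_ne_one (congrArg Octonion.c0 h1)
    have h2 := T.le_opNorm z
    rw [h.2.2 z, norm_smul, Real.norm_eq_abs] at h2
    exact le_of_mul_le_mul_right h2 ((norm_nonneg _).lt_of_ne' hz)
  · simp

lemma IsEigenbasis.isBddOct_pow (h : IsEigenbasis T B lam) (k : ℕ) :
    IsBddOct fun q : spectralSet lam => (q : ℝ) ^ k • (1 : Octonion) := by
  refine ⟨‖T‖ ^ k, ?_⟩
  rintro _ ⟨q, rfl⟩
  simp only [abs_smul_one, abs_pow]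
  exact pow_le_pow_left₀ (_root_.abs_nonneg _) (h.abs_le_norm q) k

end Powers

/-! ### Bounded octonion-valued functions. -/

section Bounded

set_option maxHeartbeats 1000000 in
lemma Octonion.abs_mul (p q : Octonion) : (p * q).abs = p.abs * q.abs := by
  refine (sq_eq_sq₀ (abs_nonneg _) (mul_nonneg (abs_nonneg _) (abs_nonneg _))).1 ?_
  rw [mul_pow, abs_sq, abs_sq, abs_sq, mul_conj_re, mul_conj_re, mul_conj_re]
  simp only [mul_def]
  ring

variable {X : Type*} {f g : X → Octonion}

lemma IsBddOct.abs_le (h : IsBddOct f) (q : X) : (f q).abs ≤ octSupNorm f := le_ciSup h q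

lemma octSupNorm_nonneg (f : X → Octonion) : 0 ≤ octSupNorm f :=
  Real.iSup_nonneg fun _ => Octonion.abs_nonneg _

lemma IsBddOct.mul (hf : IsBddOct f) (hg : IsBddOct g) : IsBddOct fun q => f q * g q := by
  refine ⟨octSupNorm f * octSupNorm g, Set.forall_mem_range.2 fun q => ?_⟩
  rw [Octonion.abs_mul]
  exact mul_le_mul (hf.abs_le q) (hg.abs_le q) (Octonion.abs_nonneg _) (octSupNorm_nonneg f)

lemma IsBddOct.conj (hf : IsBddOct f) : IsBddOct fun q => (f q).conj := by
  simpa only [IsBddOct, Octonion.abs_conj] using hf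

lemma isBddOct_const (p : Octonion) : IsBddOct fun _ : X => p :=
  ⟨p.abs, Set.forall_mem_range.2 fun _ => le_rfl⟩

end Bounded

end FunctionalCalculus

open OctBimodule HilbertOctBimodule in
theorem mainTheorem10 {H : Type*} [NormedAddCommGroup H] [InnerProductSpace ℝ H] [CompleteSpace H]
    [HilbertOctBimodule H] (T : H →L[ℝ] H)
    (hT_para : IsParaLinear (T : H →ₗ[ℝ] H))
    (hT_compact : IsCompactOperator T)
    (hT_self : IsOctAdjoint T T)
    -- only the real eigenvalues have to be standard strong
    (hT_eig : ∀ μ : ℝ, (∃ x : H, x ≠ 0 ∧ T x = μ • x) →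
      IsStandardStrongEigenvalue T (μ • (1 : Octonion))) :
    (∃ (B : Set H) (lam : B → ℝ), IsEigenbasis T B lam) ∧
    ∀ (B : Set H) (lam : B → ℝ), IsEigenbasis T B lam →
    ∃ Φ Ψ : (spectralSet lam → Octonion) → (H →L[ℝ] H),
      -- `Φ` and `Ψ` are the right and left functional calculi, with values in para-linear operators
      (∀ f, IsBddOct f →
        IsParaLinear (Φ f : H →ₗ[ℝ] H) ∧
        (∀ x : H, HasSum
          (fun z : B => octRSmul (sliceProj (z : H)) (f (spectralPt lam z)) x) (Φ f x)) ∧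
        IsParaLinear (Ψ f : H →ₗ[ℝ] H) ∧
        (∀ x : H, HasSum
          (fun z : B => octLSmul (f (spectralPt lam z)) (sliceProj (z : H)) x) (Ψ f x))) ∧
      -- power preservation: both calculi send `q ^ k` to the unique bounded para-linear operator
      -- that agrees with `T ^ k` on `Re H`
      (∀ (k : ℕ) (S : H →L[ℝ] H),
        ((IsParaLinear (S : H →ₗ[ℝ] H) ∧ ∀ x ∈ octRe H, S x = (T ^ k) x) ↔
          S = Φ (fun q => ((q : ℝ) ^ k) • (1 : Octonion))) ∧
        ((IsParaLinear (S : H →ₗ[ℝ] H) ∧ ∀ x ∈ octRe H, S x = (T ^ k) x) ↔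
          S = Ψ (fun q => ((q : ℝ) ^ k) • (1 : Octonion)))) ∧
      -- real-linearity, right para-linearity of `Φ`, left para-linearity of `Ψ`
      (∀ f g, IsBddOct f → IsBddOct g → Φ (f + g) = Φ f + Φ g ∧ Ψ (f + g) = Ψ f + Ψ g) ∧
      (∀ f, IsBddOct f → ∀ r : ℝ, Φ (r • f) = r • Φ f ∧ Ψ (r • f) = r • Ψ f) ∧
      (∀ f, IsBddOct f → ∀ p : Octonion,
        octOpRe (octRSmul (Φ f : H →ₗ[ℝ] H) p - (Φ (fun q => f q * p) : H →ₗ[ℝ] H)) = 0 ∧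
        octOpRe (octLSmul p (Ψ f : H →ₗ[ℝ] H) - (Ψ (fun q => p * f q) : H →ₗ[ℝ] H)) = 0) ∧
      -- multiplicativity of the real part
      (∀ f g, IsBddOct f → IsBddOct g → (∀ q, (f q).IsReal) →
        octOpRe (Φ (fun q => f q * g q) : H →ₗ[ℝ] H) =
          octOpRe (octComp (Φ f : H →ₗ[ℝ] H) (Φ g : H →ₗ[ℝ] H))) ∧
      (∀ f g, IsBddOct f → IsBddOct g → ((∀ q, (f q).IsReal) ∨ ∀ q, (g q).IsReal) →
        octOpRe (Ψ (fun q => f q * g q) : H →ₗ[ℝ] H) =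
          octOpRe (octComp (Ψ f : H →ₗ[ℝ] H) (Ψ g : H →ₗ[ℝ] H))) ∧
      -- involution: `Φ (f*)` is the adjoint of `Ψ f`, and `Ψ (f*)` is the adjoint of `Φ f`
      (∀ f, IsBddOct f →
        IsOctAdjoint (Ψ f) (Φ fun q => (f q).conj) ∧
        IsOctAdjoint (Φ f) (Ψ fun q => (f q).conj)) ∧
      -- norm bounds
      (∀ f, IsBddOct f → (∀ q, (f q).IsReal) →
        ‖Φ f‖ ≤ octSupNorm f ∧ ‖Ψ f‖ ≤ octSupNorm f) ∧
      (∀ f, IsBddOct f → ‖Φ f‖ ≤ 8 * octSupNorm f ∧ ‖Ψ f‖ ≤ 8 * octSupNorm f) := by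
  refine ⟨exists_isEigenbasis T hT_para hT_compact hT_self hT_eig, fun B lam hT => ?_⟩
  have hB := hT.isSliceBasis
  -- The calculi are total functions: where the series has no bounded sum the value `0` is used.
  -- Uniqueness of the sum then identifies the chosen value whenever the series converges to an
  -- operator.
  have hΦ (f : spectralSet lam → Octonion) : ∃ A : H →L[ℝ] H,
      ∀ D, HasRightSum B (fun z => f (spectralPt lam z)) D → A = D := by
    by_cases h : ∃ D, HasRightSum B (fun z => f (spectralPt lam z)) D
    · exact h.imp fun A hA D hD => hA.unique hD
    · exact ⟨0, fun D hD => absurd ⟨D, hD⟩ h⟩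
  have hΨ (f : spectralSet lam → Octonion) : ∃ A : H →L[ℝ] H,
      ∀ D, HasLeftSum B (fun z => f (spectralPt lam z)) D → A = D := by
    by_cases h : ∃ D, HasLeftSum B (fun z => f (spectralPt lam z)) D
    · exact h.imp fun A hA D hD => hA.unique hD
    · exact ⟨0, fun D hD => absurd ⟨D, hD⟩ h⟩
  choose Φ hΦ using hΦ
  choose Ψ hΨ using hΨ
  have R (f) (hf : IsBddOct f) : HasRightSum B (fun z => f (spectralPt lam z)) (Φ f) ∧
      ‖Φ f‖ ≤ 8 * octSupNorm f := by
    obtain ⟨D, hD, hDn⟩ := hB.exists_right (octSupNorm_nonneg f)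
      fun z => hf.abs_le (spectralPt lam z)
    rw [hΦ f D hD]
    exact ⟨hD, hDn⟩
  have L (f) (hf : IsBddOct f) : HasLeftSum B (fun z => f (spectralPt lam z)) (Ψ f) ∧
      ‖Ψ f‖ ≤ 8 * octSupNorm f := by
    obtain ⟨D, hD, hDn⟩ := hB.exists_left (octSupNorm_nonneg f)
      fun z => hf.abs_le (spectralPt lam z)
    rw [hΨ f D hD]
    exact ⟨hD, hDn⟩
  refine ⟨Φ, Ψ, fun f hf => ?_, fun k S => ?_, fun f g hf hg => ?_, fun f hf r => ?_,
    fun f hf p => ?_, fun f g hf hg hfr => ?_, fun f g hf hg hr => ?_, fun f hf => ?_,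
    fun f hf hfr => ?_, fun f hf => ⟨(R f hf).2, (L f hf).2⟩⟩
  · exact ⟨(R f hf).1.isParaLinear hB, (R f hf).1, (L f hf).1.isParaLinear hB, (L f hf).1⟩
  · have hk := hT.isBddOct_pow k
    exact ⟨(R _ hk).1.eq_iff hB hT_para hT.2.2 S,
      ((L _ hk).1.hasRightSum fun z => ⟨lam z ^ k, rfl⟩).eq_iff hB hT_para hT.2.2 S⟩
  · exact ⟨hΦ _ _ ((R f hf).1.add (R g hg).1), hΨ _ _ ((L f hf).1.add (L g hg).1)⟩
  · exact ⟨hΦ _ _ ((R f hf).1.smul r), hΨ _ _ ((L f hf).1.smul r)⟩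
  · exact ⟨(R f hf).1.octOpRe_octRSmul_sub (R _ (hf.mul (isBddOct_const p))).1 hB,
      (L f hf).1.octOpRe_octLSmul_sub (L _ ((isBddOct_const p).mul hf)).1 hB⟩
  · exact (R f hf).1.octOpRe_mul (R g hg).1 (R _ (hf.mul hg)).1 hB fun z => hfr _
  · rcases hr with hr | hr
    · exact (L f hf).1.octOpRe_mul_of_left (L g hg).1 (L _ (hf.mul hg)).1 hB fun z => hr _
    · exact (L f hf).1.octOpRe_mul_of_right (L g hg).1 (L _ (hf.mul hg)).1 hB fun z => hr _
  · refine ⟨(R _ hf.conj).1.isOctAdjoint ?_, (R f hf).1.isOctAdjoint' (L _ hf.conj).1⟩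
    simp only [Octonion.conj_conj]
    exact (L f hf).1
  · exact ⟨(R f hf).1.norm_le hB (fun z => hfr _) (octSupNorm_nonneg f) fun z => hf.abs_le _,
      ((L f hf).1.hasRightSum fun z => hfr _).norm_le hB (fun z => hfr _) (octSupNorm_nonneg f)
        fun z => hf.abs_le _⟩
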